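/- For a set $S\subset\mathbb{R}^2$ and an integer $p\ge 0$ let $\bigwedge^p S=\{\sum_{m\in T}m \mid T\subseteq S,\ \#T=p\}$ be the set of all sums of $p$ distinct elements of $S$. A convex lattice polytope in $\mathbb{R}^2$ (or lattice polygon; it may be a point or a segment) is the convex hull of a nonempty finite subset of $\mathbb{Z}^2$. Two lattice polygons $P,Q$ are called equivalent if there is an affine transformation $T:\mathbb{R}^2\to\mathbb{R}^2$ with $T(\mathbb{Z}^2)=\mathbb{Z}^2$ and $T(P)=Q$. For an integer $k\ge 1$ let $\Delta_k=\mathrm{conv}\{(-1,-1),(0,1),(k,0)\}$. Let $P\subset\mathbb{R}^2$ be a convex lattice polygon and let $N=\#(P\cap\mathbb{Z}^2)$. (i) If $P$ is not equivalent to $\Delta_k$ for any $k\ge 1$, then for every integer $p$ with $0\le p\le N$ the set $\bigwedge^p(P\cap\mathbb{Z}^2)$ is the set of all lattice points of some convex lattice polytope. (ii) If $P$ is equivalent to $\Delta_k$ for some $k\ge 1$ and $N\ge 6$, then for every integer $p$ with $0\le p\le N$ and $p\notin\{2,N-2\}$ the set $\bigwedge^p(P\cap\mathbb{Z}^2)$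 is the set of all lattice points of some convex lattice polytope. -/

import Mathlib

/-- The lattice points of `ℝⁿ`: the points all of whose coordinates are integers. -/
def latticePoints (n : ℕ) : Set (Fin n → ℝ) :=
  {x | ∀ i, ∃ z : ℤ, x i = (z : ℝ)}

/-- A (convex) lattice polytope in `ℝⁿ`: the convex hull of a nonempty finite set of lattice
points. It need not be full-dimensional. -/
def IsLatticePolytope {n : ℕ} (P : Set (Fin n → ℝ)) : Prop :=
  ∃ F : Finset (Fin n → ℝ), F.Nonempty ∧ (F : Set (Fin n → ℝ)) ⊆ latticePoints n ∧
    P = convexHull ℝ (F : Set (Fin n → ℝ))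

/-- The `p`-th wedge power of `S`: all sums of `p` distinct elements of `S`. -/
def wedgePower {n : ℕ} (p : ℕ) (S : Set (Fin n → ℝ)) : Set (Fin n → ℝ) :=
  {x | ∃ T : Finset (Fin n → ℝ), (T : Set (Fin n → ℝ)) ⊆ S ∧ T.card = p ∧ ∑ m ∈ T, m = x}

/-- Unimodular equivalence: some affine transformation of `ℝⁿ` that maps the lattice `ℤⁿ` onto
itself maps `P` onto `Q`. -/
def LatticeEquivalent {n : ℕ} (P Q : Set (Fin n → ℝ)) : Prop :=
  ∃ T : (Fin n → ℝ) ≃ᵃ[ℝ] (Fin n → ℝ), T '' latticePoints n = latticePoints n ∧ T '' P = Q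

/-- The triangle with vertices `(-1, -1)`, `(0, 1)` and `(k, 0)`. -/
def exceptionalTriangle (k : ℕ) : Set (Fin 2 → ℝ) :=
  convexHull ℝ {![-1, -1], ![0, 1], ![(k : ℝ), 0]}

/-- `S` is exactly the set of lattice points of some convex lattice polytope. -/
def IsLatticeConvex {n : ℕ} (S : Set (Fin n → ℝ)) : Prop :=
  ∃ Q : Set (Fin n → ℝ), IsLatticePolytope Q ∧ S = Q ∩ latticePoints n

/-- A lattice polytope has finitely many lattice points, so `Set.ncard` really counts them. -/
theorem IsLatticePolytope.finite_inter_latticePoints {n : ℕ} {P : Set (Fin n → ℝ)}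
    (hP : IsLatticePolytope P) : (P ∩ latticePoints n).Finite := by
  obtain ⟨F, -, -, rfl⟩ := hP
  have hb : Bornology.IsBounded (convexHull ℝ (F : Set (Fin n → ℝ))) :=
    isBounded_convexHull.2 F.finite_toSet.isBounded
  obtain ⟨R, hR⟩ := hb.exists_norm_le
  have hfin : (Set.pi Set.univ fun _ : Fin n => Set.Icc (-⌈R⌉) ⌈R⌉).Finite :=
    Set.Finite.pi fun _ => Set.finite_Icc _ _
  refine (hfin.image fun (z : Fin n → ℤ) i => (z i : ℝ)).subset ?_
  rintro x ⟨hx, hl⟩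
  choose z hz using hl
  refine ⟨z, fun i _ => ?_, funext fun i => (hz i).symm⟩
  have h := (norm_le_pi_norm x i).trans ((hR x hx).trans (Int.le_ceil R))
  rw [hz i, Real.norm_eq_abs, abs_le] at h
  exact ⟨by exact_mod_cast h.1, by exact_mod_cast h.2⟩

/-! Let S be the set of lattice points of P and N its size. A point of the hull of the wedge power
is a fractional sum of S: weights in [0, 1] with total p. The task is to turn a lattice point x with
such weights into a sum of p distinct points, by induction on N. If some choice of weights for x is
0 or 1 at a vertex v of the hull, delete v, which keeps S saturated, and continue with (x, p) or (x
- v, p - 1). Otherwise the weights at the vertices are trapped in the open interval. Then there are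
at most three vertices, and p and N - p are both smaller than their number. Apart from p = 1 and N -
p = 1, this leaves a triangle with one further lattice point c and p = 2, where only x = 2c can
fail.

So the only obstruction is an isolated center o, with x = 2o or, dually, x = ∑ S - 2o; this is
`mem_wedgePower_or_center`. When v is put back, 2o either splits or remains an obstruction of the
same kind, with o still isolated. The remaining cases reduce to writing v + 2o as a sum of three
distinct points (`IsIsolatedCenter.sum_three_of_erase`). That fails only in a five-point
configuration with v + 4o = ∑ S, where x is again one of the two listed obstructions.

Seen from an isolated center, S has no antipodes and contains the lattice points of every triangle
with apex o and two corners in S. Shrinking a triangle around o produces vectors a, b, -(a + b) of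
determinant one. All points lie on these three rays, and only one ray can go beyond its first point,
so P is some Δ_k (`IsIsolatedCenter.latticeEquivalent`). Hence (i) has no obstruction at all, and in
(ii) obstructions live only at p = 2 and p = N - 2. -/

/-- A finite set of lattice points containing every lattice point of its convex hull. -/
def LatticeSaturated {n : ℕ} (S : Finset (Fin n → ℝ)) : Prop :=
  (S : Set (Fin n → ℝ)) ⊆ latticePoints n ∧
    ∀ x ∈ latticePoints n, x ∈ convexHull ℝ (S : Set (Fin n → ℝ)) → x ∈ S

/-- `w` is a point of the hypersimplex (`0 ≤ w ≤ 1`, total weight `p`) lying over `x`. -/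
def IsFractionalSum {n : ℕ} (S : Finset (Fin n → ℝ)) (p : ℕ) (x : Fin n → ℝ)
    (w : (Fin n → ℝ) → ℝ) : Prop :=
  (∀ s ∈ S, 0 ≤ w s ∧ w s ≤ 1) ∧ ∑ s ∈ S, w s = p ∧ ∑ s ∈ S, w s • s = x

/-- A point of `S` in the hull of the others that is not the midpoint of two others. -/
def IsIsolatedCenter {n : ℕ} (S : Finset (Fin n → ℝ)) (o : Fin n → ℝ) : Prop :=
  o ∈ S ∧ o ∈ convexHull ℝ ((S : Set (Fin n → ℝ)) \ {o}) ∧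
    ∀ u ∈ S, ∀ w ∈ S, u + w = o + o → u = w

/-! ### Lattice points and wedge powers. -/

theorem sub_mem_latticePoints {n : ℕ} {x y : Fin n → ℝ} (hx : x ∈ latticePoints n)
    (hy : y ∈ latticePoints n) : x - y ∈ latticePoints n := fun i => by
  obtain ⟨a, ha⟩ := hx i
  obtain ⟨b, hb⟩ := hy i
  exact ⟨a - b, by simp [ha, hb]⟩

theorem zero_mem_latticePoints {n : ℕ} : (0 : Fin n → ℝ) ∈ latticePoints n :=
  fun _ => ⟨0, by simp⟩

theorem add_mem_latticePoints {n : ℕ} {x y : Fin n → ℝ} (hx : x ∈ latticePoints n)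
    (hy : y ∈ latticePoints n) : x + y ∈ latticePoints n := by
  simpa using sub_mem_latticePoints hx (sub_mem_latticePoints zero_mem_latticePoints hy)

theorem sum_mem_latticePoints {n : ℕ} {S : Finset (Fin n → ℝ)}
    (hS : (S : Set (Fin n → ℝ)) ⊆ latticePoints n) : ∑ s ∈ S, s ∈ latticePoints n := by
  classical
  exact Finset.sum_induction _ (· ∈ latticePoints n) (fun _ _ => add_mem_latticePoints)
    zero_mem_latticePoints (fun s hs => hS hs)

theorem wedgePower_mono {n p : ℕ} {S T : Set (Fin n → ℝ)} (h : S ⊆ T) :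
    wedgePower p S ⊆ wedgePower p T :=
  fun _ ⟨U, hU, hc, hs⟩ => ⟨U, hU.trans h, hc, hs⟩

theorem add_mem_wedgePower_succ {n p : ℕ} {S : Finset (Fin n → ℝ)} {v x : Fin n → ℝ}
    (hv : v ∈ S) (hx : x ∈ wedgePower p (S.erase v : Set (Fin n → ℝ))) :
    v + x ∈ wedgePower (p + 1) (S : Set (Fin n → ℝ)) := by
  classical
  obtain ⟨U, hU, rfl, rfl⟩ := hx
  have hvU : v ∉ U := fun h => by simpa using hU h
  refine ⟨insert v U, ?_, Finset.card_insert_of_notMem hvU, Finset.sum_insert hvU⟩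
  intro y hy
  rcases Finset.mem_insert.1 (Finset.mem_coe.1 hy) with rfl | hy
  · exact hv
  · exact Finset.mem_of_mem_erase (Finset.mem_coe.1 (hU hy))

/-- Replacing a subset by its complement exchanges p with N - p, so each dual case follows from the
one with few summands. -/
theorem wedgePower_compl {n p q : ℕ} {S : Finset (Fin n → ℝ)} {x y : Fin n → ℝ}
    (hpq : p + q = S.card) (hxy : x + y = ∑ s ∈ S, s)
    (hx : x ∈ wedgePower p (S : Set (Fin n → ℝ))) :
    y ∈ wedgePower q (S : Set (Fin n → ℝ)) := by
  classical
  obtain ⟨U, hU, rfl, rfl⟩ := hx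
  have hU' : U ⊆ S := by exact_mod_cast hU
  refine ⟨S \ U, by simp, ?_, ?_⟩
  · rw [Finset.card_sdiff_of_subset hU']; omega
  · have := Finset.sum_sdiff (f := fun s => s) hU'
    rw [← hxy, add_comm] at this
    exact add_left_cancel this

theorem mem_wedgePower_one {n : ℕ} {S : Set (Fin n → ℝ)} {x : Fin n → ℝ} (hx : x ∈ S) :
    x ∈ wedgePower 1 S :=
  ⟨{x}, by simpa using hx, by simp, by simp⟩

theorem add_mem_wedgePower_two {n : ℕ} {S : Set (Fin n → ℝ)} {x y : Fin n → ℝ} (hx : x ∈ S)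
    (hy : y ∈ S) (hxy : x ≠ y) : x + y ∈ wedgePower 2 S := by
  classical
  exact ⟨{x, y}, by simp [Set.insert_subset_iff, hx, hy], Finset.card_pair hxy,
    Finset.sum_pair hxy⟩

theorem add_mem_wedgePower_three {n : ℕ} {S : Set (Fin n → ℝ)} {x y z : Fin n → ℝ} (hx : x ∈ S)
    (hy : y ∈ S) (hz : z ∈ S) (hxy : x ≠ y) (hxz : x ≠ z) (hyz : y ≠ z) :
    x + y + z ∈ wedgePower 3 S := by
  classical
  refine ⟨{x, y, z}, by simp [Set.insert_subset_iff, hx, hy, hz],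
    Finset.card_eq_three.2 ⟨x, y, z, hxy, hxz, hyz, rfl⟩, ?_⟩
  rw [Finset.sum_insert (by simp [hxy, hxz]), Finset.sum_pair hyz, add_assoc]

/-! ### Fractional sums: complements and deletion of a point. -/

namespace IsFractionalSum

variable {n p : ℕ} {S : Finset (Fin n → ℝ)} {x : Fin n → ℝ} {w : (Fin n → ℝ) → ℝ}

theorem le_card (h : IsFractionalSum S p x w) : p ≤ S.card := by
  have : (p : ℝ) ≤ S.card := by
    rw [← h.2.1]
    calc ∑ s ∈ S, w s ≤ ∑ _s ∈ S, (1 : ℝ) := Finset.sum_le_sum fun s hs => (h.1 s hs).2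
      _ = S.card := by simp
  exact_mod_cast this

theorem compl {q : ℕ} {y : Fin n → ℝ} (h : IsFractionalSum S p x w) (hpq : p + q = S.card)
    (hxy : x + y = ∑ s ∈ S, s) : IsFractionalSum S q y (fun s => 1 - w s) := by
  refine ⟨fun s hs => ⟨by linarith [(h.1 s hs).2], by linarith [(h.1 s hs).1]⟩, ?_, ?_⟩
  · have : (p : ℝ) + q = S.card := by exact_mod_cast hpq
    rw [Finset.sum_sub_distrib, h.2.1]
    simp; linarith
  · simp only [sub_smul, one_smul]
    rw [Finset.sum_sub_distrib, h.2.2, ← hxy]; abel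

theorem erase_of_eq_zero {v : Fin n → ℝ} (h : IsFractionalSum S p x w) (hv : v ∈ S)
    (hw : w v = 0) : IsFractionalSum (S.erase v) p x w := by
  refine ⟨fun s hs => h.1 s (Finset.mem_of_mem_erase hs), ?_, ?_⟩
  · rw [← h.2.1, ← Finset.add_sum_erase S w hv, hw, zero_add]
  · rw [← h.2.2, ← Finset.add_sum_erase S (fun s => w s • s) hv, hw, zero_smul, zero_add]

theorem erase_of_eq_one {v : Fin n → ℝ} (h : IsFractionalSum S p x w) (hv : v ∈ S)
    (hw : w v = 1) : ∃ q, p = q + 1 ∧ IsFractionalSum (S.erase v) q (x - v) w := by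
  have h0 : ∀ s ∈ S.erase v, 0 ≤ w s := fun s hs => (h.1 s (Finset.mem_of_mem_erase hs)).1
  have h1 : (p : ℝ) = 1 + ∑ s ∈ S.erase v, w s := by
    rw [← h.2.1, ← Finset.add_sum_erase S w hv, hw]
  have hp : 1 ≤ p := by
    have : (1 : ℝ) ≤ p := by rw [h1]; linarith [Finset.sum_nonneg h0]
    exact_mod_cast this
  obtain ⟨q, rfl⟩ : ∃ q, p = q + 1 := ⟨p - 1, by omega⟩
  refine ⟨q, rfl, fun s hs => h.1 s (Finset.mem_of_mem_erase hs), ?_, ?_⟩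
  · push_cast at h1; linarith
  · rw [← h.2.2, ← Finset.add_sum_erase S (fun s => w s • s) hv, hw, one_smul,
      add_sub_cancel_left]

theorem mem_convexHull (h : IsFractionalSum S 1 x w) :
    x ∈ convexHull ℝ (S : Set (Fin n → ℝ)) :=
  Finset.mem_convexHull'.2 ⟨w, fun s hs => (h.1 s hs).1, by simpa using h.2.1, h.2.2⟩

end IsFractionalSum

/-- The least slack in the constraints is continuous along the segment, nonnegative at time 0 and
nonpositive at time 1. At a zero all constraints hold and one is tight. -/
theorem exists_first_exit {ι : Type*} (V : Finset ι) (w ν : ι → ℝ)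
    (hw : ∀ v ∈ V, 0 < w v ∧ w v < 1)
    (hex : ∃ v ∈ V, ¬ (0 < w v + ν v ∧ w v + ν v < 1)) :
    ∃ t : ℝ, 0 ≤ t ∧ t ≤ 1 ∧ (∀ v ∈ V, 0 ≤ w v + t * ν v ∧ w v + t * ν v ≤ 1) ∧
      ∃ v ∈ V, w v + t * ν v = 0 ∨ w v + t * ν v = 1 := by
  obtain ⟨v₀, hv₀, hex⟩ := hex
  have hne : V.Nonempty := ⟨v₀, hv₀⟩
  let g : ℝ → ℝ := fun t => V.inf' hne fun v => min (w v + t * ν v) (1 - (w v + t * ν v))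
  have hg : Continuous g := Continuous.finset_inf'_apply hne fun v _ => by fun_prop
  have hg0 : 0 ≤ g 0 := by
    refine (Finset.le_inf'_iff hne _).2 fun v hv => ?_
    have := hw v hv
    rw [zero_mul, add_zero]
    exact le_min this.1.le (by linarith)
  have hg1 : g 1 ≤ 0 := by
    refine (Finset.inf'_le _ hv₀).trans ?_
    rw [one_mul]
    by_contra! hc
    rw [lt_min_iff] at hc
    exact hex ⟨hc.1, by linarith⟩
  obtain ⟨t, ⟨ht0, ht1⟩, ht⟩ :=
    intermediate_value_Icc' (zero_le_one' ℝ) hg.continuousOn ⟨hg1, hg0⟩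
  refine ⟨t, ht0, ht1, fun v hv => ?_, ?_⟩
  · have : (0 : ℝ) ≤ min (w v + t * ν v) (1 - (w v + t * ν v)) := by
      rw [← ht]; exact Finset.inf'_le (fun v => min (w v + t * ν v) (1 - (w v + t * ν v))) hv
    rw [le_min_iff] at this
    exact ⟨this.1, by linarith⟩
  · obtain ⟨v, hv, hvt⟩ := Finset.exists_mem_eq_inf' hne
      fun v => min (w v + t * ν v) (1 - (w v + t * ν v))
    have hvt' : min (w v + t * ν v) (1 - (w v + t * ν v)) = 0 := by rw [← hvt]; exact ht
    refine ⟨v, hv, ?_⟩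
    rcases min_choice (w v + t * ν v) (1 - (w v + t * ν v)) with h | h
    · left; rw [← h, hvt']
    · right; linarith

/-! ### Points whose weights at the vertices are never 0 or 1. -/

section InteriorFibre

variable {n p : ℕ} {S V : Finset (Fin n → ℝ)} {x : Fin n → ℝ} {w : (Fin n → ℝ) → ℝ}

/-- If no fractional representation of `x` has weight `0` or `1` on a vertex, then there is one
supported on the vertices. -/
theorem exists_fractionalSum_support (hVS : V ⊆ S) (hVn : V.Nonempty)
    (hconv : (S : Set (Fin n → ℝ)) ⊆ convexHull ℝ (V : Set (Fin n → ℝ)))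
    (hw : IsFractionalSum S p x w)
    (hint : ∀ w, IsFractionalSum S p x w → ∀ v ∈ V, 0 < w v ∧ w v < 1) :
    ∃ w, IsFractionalSum S p x w ∧ ∀ s ∈ S, s ∉ V → w s = 0 := by
  classical
  have hp : (0 : ℝ) < p := by
    obtain ⟨v, hv⟩ := hVn
    rw [← hw.2.1]
    exact Finset.sum_pos' (fun s hs => (hw.1 s hs).1) ⟨v, hVS hv, (hint w hw v hv).1⟩
  have hc : (p : ℝ)⁻¹ • x ∈ convexHull ℝ (V : Set (Fin n → ℝ)) := by
    refine convexHull_min hconv (convex_convexHull ℝ _) ?_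
    refine Finset.mem_convexHull'.2 ⟨fun s => (p : ℝ)⁻¹ * w s,
      fun s hs => mul_nonneg (by positivity) (hw.1 s hs).1, ?_, ?_⟩
    · rw [← Finset.mul_sum, hw.2.1]; field_simp
    · simp only [mul_smul]
      rw [← Finset.smul_sum, hw.2.2]
  obtain ⟨β, hβ0, hβ1, hβx⟩ := Finset.mem_convexHull'.1 hc
  set μ : (Fin n → ℝ) → ℝ := fun s => if s ∈ V then p * β s else 0 with hμ
  have hμ1 : ∑ s ∈ S, μ s = p := by
    rw [hμ, Finset.sum_ite_mem, Finset.inter_eq_right.2 hVS, ← Finset.mul_sum, hβ1, mul_one]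
  have hμx : ∑ s ∈ S, μ s • s = x := by
    simp only [hμ, ite_smul, zero_smul]
    rw [Finset.sum_ite_mem, Finset.inter_eq_right.2 hVS]
    simp only [mul_smul]
    rw [← Finset.smul_sum, hβx, smul_smul, mul_inv_cancel₀ hp.ne', one_smul]
  have hμ0 : ∀ s, s ∉ V → μ s = 0 := fun s hs => by simp [hμ, hs]
  -- Move from w towards μ. Weights off V only shrink, so the first constraint reached would be at a
  -- vertex, against `hint`. Hence μ itself is admissible.
  by_cases hex : ∃ v ∈ V, ¬ (0 < w v + (μ v - w v) ∧ w v + (μ v - w v) < 1)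
  · exfalso
    obtain ⟨t, ht0, ht1, htV, v, hv, hvt⟩ :=
      exists_first_exit V w (fun v => μ v - w v) (hint w hw) hex
    have hf : IsFractionalSum S p x fun s => w s + t * (μ s - w s) := by
      refine ⟨fun s hs => ?_, ?_, ?_⟩
      · by_cases hsV : s ∈ V
        · exact htV s hsV
        · have := hw.1 s hs
          simp only [hμ0 s hsV]
          constructor <;> nlinarith
      · rw [Finset.sum_add_distrib, ← Finset.mul_sum, Finset.sum_sub_distrib, hμ1, hw.2.1]; ring
      · simp only [add_smul, mul_smul, sub_smul]
        rw [Finset.sum_add_distrib, ← Finset.smul_sum, Finset.sum_sub_distrib, hμx, hw.2.2]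
        simp
    have := hint _ hf v hv
    rcases hvt with h | h <;> simp only [h] at this <;> linarith
  · push Not at hex
    refine ⟨μ, ⟨fun s hs => ?_, hμ1, hμx⟩, fun s _ hs => hμ0 s hs⟩
    by_cases hsV : s ∈ V
    · have := hex s hsV
      simp only [add_sub_cancel] at this
      exact ⟨this.1.le, this.2.le⟩
    · rw [hμ0 s hsV]; simp

theorem lt_card_of_support (hVS : V ⊆ S) (hVn : V.Nonempty)
    (hw : IsFractionalSum S p x w) (hwV : ∀ s ∈ S, s ∉ V → w s = 0)
    (hint : ∀ v ∈ V, 0 < w v ∧ w v < 1) : p < V.card := by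
  have : (p : ℝ) < V.card := by
    rw [← hw.2.1, ← Finset.sum_subset hVS hwV]
    calc ∑ s ∈ V, w s < ∑ _s ∈ V, (1 : ℝ) :=
          Finset.sum_lt_sum_of_nonempty hVn fun s hs => (hint s hs).2
      _ = V.card := by simp
  exact_mod_cast this

/-- More than n + 1 vertices are affinely dependent, and moving the weights along a dependence
eventually makes some vertex weight 0 or 1. -/
theorem card_le_of_interior (hVS : V ⊆ S) (hw : IsFractionalSum S p x w)
    (hint : ∀ w, IsFractionalSum S p x w → ∀ v ∈ V, 0 < w v ∧ w v < 1) : V.card ≤ n + 1 := by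
  classical
  by_contra! hcard
  obtain ⟨f, hfx, hf0, v₀, hv₀, hfv⟩ :=
    Module.exists_nontrivial_relation_sum_zero_of_finrank_succ_lt_card (R := ℝ) (t := V)
      (by simpa using hcard)
  -- The scaling gives ν the value 1 at v₀, which forces the weight there out of the open interval
  -- by time 1.
  let ν : (Fin n → ℝ) → ℝ := fun s => if s ∈ V then (f v₀)⁻¹ * f s else 0
  have hν1 : ∑ s ∈ S, ν s = 0 := by
    simp only [ν]
    rw [Finset.sum_ite_mem, Finset.inter_eq_right.2 hVS, ← Finset.mul_sum, hf0, mul_zero]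
  have hνx : ∑ s ∈ S, ν s • s = 0 := by
    simp only [ν, ite_smul, zero_smul]
    rw [Finset.sum_ite_mem, Finset.inter_eq_right.2 hVS]
    simp only [mul_smul]
    rw [← Finset.smul_sum, hfx, smul_zero]
  obtain ⟨t, -, -, htV, v, hv, hvt⟩ := exists_first_exit V w ν (hint w hw) ⟨v₀, hv₀, by
    have := hint w hw v₀ hv₀
    simp only [ν, if_pos hv₀, inv_mul_cancel₀ hfv]
    intro h; linarith⟩
  have hf : IsFractionalSum S p x fun s => w s + t * ν s := by
    refine ⟨fun s hs => ?_, ?_, ?_⟩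
    · by_cases hsV : s ∈ V
      · exact htV s hsV
      · simpa [ν, hsV] using hw.1 s hs
    · rw [Finset.sum_add_distrib, ← Finset.mul_sum, hν1, hw.2.1]; ring
    · simp only [add_smul, mul_smul]
      rw [Finset.sum_add_distrib, ← Finset.smul_sum, hνx, hw.2.2]
      simp
  have := hint _ hf v hv
  rcases hvt with h | h <;> simp only [h] at this <;> linarith

end InteriorFibre

theorem two_nsmul_dichotomy {n : ℕ} {S : Finset (Fin n → ℝ)} {o : Fin n → ℝ} (ho : o ∈ S)
    (hc : o ∈ convexHull ℝ ((S : Set (Fin n → ℝ)) \ {o})) :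
    o + o ∈ wedgePower 2 (S : Set (Fin n → ℝ)) ∨ IsIsolatedCenter S o := by
  by_cases h : ∀ u ∈ S, ∀ w ∈ S, u + w = o + o → u = w
  · exact Or.inr ⟨ho, hc, h⟩
  · push Not at h
    obtain ⟨u, hu, w, hw, huw, hne⟩ := h
    exact Or.inl (huw ▸ add_mem_wedgePower_two (by exact_mod_cast hu) (by exact_mod_cast hw) hne)

/-- Both x and its complement have weights supported on the at most three vertices, so p and q are
less than `V.card`. Only p = q = 2, with three vertices and one further point, needs an argument. -/
theorem mem_wedgePower_or_center_of_interior {p : ℕ} {S V : Finset (Fin 2 → ℝ)}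
    {x : Fin 2 → ℝ} {w : (Fin 2 → ℝ) → ℝ} (hS : LatticeSaturated S) (hx : x ∈ latticePoints 2)
    (hVS : V ⊆ S) (hVn : V.Nonempty)
    (hconv : (S : Set (Fin 2 → ℝ)) ⊆ convexHull ℝ (V : Set (Fin 2 → ℝ)))
    (hw : IsFractionalSum S p x w)
    (hint : ∀ w, IsFractionalSum S p x w → ∀ v ∈ V, 0 < w v ∧ w v < 1) :
    x ∈ wedgePower p (S : Set (Fin 2 → ℝ)) ∨
      ∃ o, IsIsolatedCenter S o ∧ p = 2 ∧ x = o + o := by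
  classical
  obtain ⟨q, hq⟩ : ∃ q, p + q = S.card := ⟨S.card - p, by have := hw.le_card; omega⟩
  have hq' : q + p = S.card := by omega
  set y := ∑ s ∈ S, s - x with hy
  have hxy : x + y = ∑ s ∈ S, s := by rw [hy]; abel
  have hyx : y + x = ∑ s ∈ S, s := by rw [hy]; abel
  have hyl : y ∈ latticePoints 2 := sub_mem_latticePoints (sum_mem_latticePoints hS.1) hx
  have hw' := hw.compl hq hxy
  have hint' : ∀ w, IsFractionalSum S q y w → ∀ v ∈ V, 0 < w v ∧ w v < 1 := fun w h v hv => by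
    have := hint _ (h.compl hq' hyx) v hv
    constructor <;> linarith
  obtain ⟨μ, hμ, hμV⟩ := exists_fractionalSum_support hVS hVn hconv hw hint
  obtain ⟨μ', hμ', hμV'⟩ := exists_fractionalSum_support hVS hVn hconv hw' hint'
  have h3 := card_le_of_interior hVS hw hint
  have hp := lt_card_of_support hVS hVn hμ hμV (hint _ hμ)
  have hq := lt_card_of_support hVS hVn hμ' hμV' (hint' _ hμ')
  have hVc := Finset.card_le_card hVS
  by_cases hp1 : p = 1
  · subst hp1
    exact Or.inl (mem_wedgePower_one (hS.2 x hx hw.mem_convexHull))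
  by_cases hq1 : q = 1
  · subst hq1
    exact Or.inl (wedgePower_compl hq' hyx (mem_wedgePower_one (hS.2 y hyl hw'.mem_convexHull)))
  have hp2 : p = 2 := by omega
  have hq2 : q = 2 := by omega
  subst hp2 hq2
  have hV3 : V.card = 3 := by omega
  have hcard : (S \ V).card = 1 := by rw [Finset.card_sdiff_of_subset hVS]; omega
  obtain ⟨c, hc⟩ := Finset.card_eq_one.1 hcard
  have hcS : c ∈ S \ V := by rw [hc]; simp
  rw [Finset.mem_sdiff] at hcS
  -- The complement does not use c, so x uses c fully; the other weights 1 - μ' have total 3 - 2 = 1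
  -- and exhibit x - c as a point of the triangle.
  have hsum : ∑ v ∈ V, (1 - μ' v) = 1 := by
    have := hμ'.2.1
    rw [← Finset.sum_subset hVS hμV'] at this
    rw [Finset.sum_sub_distrib, this]
    simp [hV3]; norm_num
  have hsumx : ∑ v ∈ V, (1 - μ' v) • v = x - c := by
    have h := hμ'.2.2
    rw [← Finset.sum_subset hVS fun s hs hs' => by rw [hμV' s hs hs', zero_smul]] at h
    simp only [sub_smul, one_smul]
    rw [Finset.sum_sub_distrib, h, hy, ← Finset.sum_sdiff hVS, hc, Finset.sum_singleton]
    abel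
  have hz : x - c ∈ convexHull ℝ (V : Set (Fin 2 → ℝ)) :=
    Finset.mem_convexHull'.2 ⟨_, fun v hv => by linarith [(hint' _ hμ' v hv).2], hsum, hsumx⟩
  have hzS : x - c ∈ S := hS.2 _ (sub_mem_latticePoints hx (hS.1 hcS.1))
    (convexHull_mono (by exact_mod_cast hVS) hz)
  by_cases hzc : c = x - c
  · have hx2 : x = c + c := by
      nth_rewrite 1 [hzc]; abel
    rw [← hzc] at hz
    have hcc : c ∈ convexHull ℝ ((S : Set (Fin 2 → ℝ)) \ {c}) := by
      have hsub : (V : Set (Fin 2 → ℝ)) ⊆ (S : Set (Fin 2 → ℝ)) \ {c} := by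
        refine fun v hv => ⟨hVS hv, ?_⟩
        rintro rfl
        exact hcS.2 hv
      exact convexHull_mono hsub hz
    rcases two_nsmul_dichotomy hcS.1 hcc with h | h
    · exact Or.inl (hx2 ▸ h)
    · exact Or.inr ⟨c, h, rfl, hx2⟩
  · left
    have := add_mem_wedgePower_two (S := (S : Set (Fin 2 → ℝ))) hcS.1 hzS hzc
    rwa [add_sub_cancel] at this

/-! ### Star-closed sets of integer vectors. -/

/-- The determinant of two integer vectors. -/
def cross (u v : ℤ × ℤ) : ℤ := u.1 * v.2 - u.2 * v.1

/-- `I` contains the origin and all integer points of the triangles `0`, `u`, `v` with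
`u, v ∈ I`. -/
def StarClosed (I : Set (ℤ × ℤ)) : Prop :=
  (0, 0) ∈ I ∧ ∀ u ∈ I, ∀ v ∈ I, ∀ (q : ℤ × ℤ) (α β D : ℤ), 0 ≤ α → 0 ≤ β → α + β ≤ D → 0 < D →
    D * q.1 = α * u.1 + β * v.1 → D * q.2 = α * u.2 + β * v.2 → q ∈ I

/-- No nonzero vector of `I` has its negative in `I`. -/
def NoAntipodes (I : Set (ℤ × ℤ)) : Prop := ∀ u ∈ I, -u ∈ I → u = 0

/-- Three vectors `a`, `b`, `-(a + b)` of `I`, with `a, b` a positively oriented basis. -/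
def UnimodularTriple (I : Set (ℤ × ℤ)) (a b : ℤ × ℤ) : Prop :=
  a ∈ I ∧ b ∈ I ∧ -(a + b) ∈ I ∧ cross a b = 1

theorem UnimodularTriple.rotate {I : Set (ℤ × ℤ)} {a b : ℤ × ℤ} (h : UnimodularTriple I a b) :
    UnimodularTriple I b (-(a + b)) := by
  obtain ⟨ha, hb, hc, hab⟩ := h
  refine ⟨hb, hc, by simpa using ha, ?_⟩
  simp only [cross, Prod.fst_neg, Prod.snd_neg, Prod.fst_add, Prod.snd_add] at *
  linarith

theorem UnimodularTriple.mono {I J : Set (ℤ × ℤ)} {a b : ℤ × ℤ} (h : UnimodularTriple I a b)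
    (hIJ : I ⊆ J) : UnimodularTriple J a b :=
  ⟨hIJ h.1, hIJ h.2.1, hIJ h.2.2.1, h.2.2.2⟩

theorem StarClosed.smul_mem {I : Set (ℤ × ℤ)} (hI : StarClosed I) {u : ℤ × ℤ} {m n : ℤ}
    (hm : 0 ≤ m) (hmn : m ≤ n) (hn : 0 < n) (hu : n • u ∈ I) : m • u ∈ I := by
  refine hI.2 _ hu _ hI.1 _ m 0 n hm le_rfl (by omega) hn ?_ ?_ <;> simp <;> ring

/-- Antiparallel vectors are multiples, of opposite signs, of one primitive vector d; star closure
would put both d and -d in I. -/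
theorem NoAntipodes.not_antiparallel {I : Set (ℤ × ℤ)} (hN : NoAntipodes I) (hI : StarClosed I)
    {u v : ℤ × ℤ} (hu : u ∈ I) (hv : v ∈ I) (h : cross u v = 0) :
    0 ≤ u.1 * v.1 + u.2 * v.2 := by
  by_contra! hd
  have hu0 : 0 < Int.gcd u.1 u.2 := by
    rw [Int.gcd_pos_iff]
    by_contra! hc
    rw [hc.1, hc.2] at hd
    simp at hd
  obtain ⟨d₁, d₂, hcop, h1, h2⟩ := Int.exists_gcd_one hu0
  set g : ℤ := (Int.gcd u.1 u.2 : ℤ) with hg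
  have hgpos : 0 < g := by rw [hg]; exact_mod_cast hu0
  obtain ⟨r, s, hrs⟩ := Int.isCoprime_iff_gcd_eq_one.2 hcop
  have hu' : u = g • (d₁, d₂) := by ext <;> simp [h1, h2] <;> ring
  have hdI : (d₁, d₂) ∈ I := by
    have := hI.smul_mem (m := 1) (by norm_num) (by omega) hgpos (hu' ▸ hu)
    simpa using this
  have hcr : d₁ * v.2 = d₂ * v.1 := by
    have : g * (d₁ * v.2 - d₂ * v.1) = 0 := by
      simp only [cross] at h; rw [h1, h2] at h; linarith
    rcases mul_eq_zero.1 this with h | h <;> omega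
  set k := r * v.1 + s * v.2 with hk
  have hv1 : v.1 = k * d₁ := by
    rw [hk]; linear_combination v.1 * (-hrs) - s * hcr
  have hv2 : v.2 = k * d₂ := by
    rw [hk]; linear_combination v.2 * (-hrs) + r * hcr
  have hk0 : k < 0 := by
    by_contra! hk0
    rw [h1, h2, hv1, hv2] at hd
    have : 0 ≤ g * k * (d₁ ^ 2 + d₂ ^ 2) := by positivity
    linarith
  have hnd : -(d₁, d₂) ∈ I := by
    have hv' : (-k) • (-(d₁, d₂)) = v := by ext <;> simp [hv1, hv2]
    have := hI.smul_mem (m := 1) (n := -k) (by norm_num) (by omega) (by omega) (hv' ▸ hv)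
    simpa using this
  have := hN _ hdI hnd
  simp only [Prod.mk_eq_zero] at this
  rw [h1, h2, this.1, this.2] at hd
  simp at hd

/-- A sublattice of index at least 2 misses a standard basis vector. Reducing that vector into the
parallelogram on a, b, and reflecting it in the centre if it lies beyond the diagonal, gives a
nonzero point of the triangle. -/
theorem exists_small_combination {a b : ℤ × ℤ} (hab : 2 ≤ cross a b) :
    ∃ (q : ℤ × ℤ) (α β : ℤ), 0 ≤ α ∧ 0 ≤ β ∧ α < cross a b ∧ β < cross a b ∧
      α + β ≤ cross a b ∧ 0 < α + β ∧ cross a b * q.1 = α * a.1 + β * b.1 ∧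
      cross a b * q.2 = α * a.2 + β * b.2 := by
  set D := cross a b with hD
  have hD' : D = a.1 * b.2 - a.2 * b.1 := hD
  have hD0 : 0 < D := by omega
  obtain ⟨e, he⟩ : ∃ e : ℤ × ℤ, ¬ (D ∣ cross e b ∧ D ∣ cross a e) := by
    by_contra! hc
    obtain ⟨⟨k₁, h₁⟩, ⟨k₂, h₂⟩⟩ := hc (1, 0)
    obtain ⟨⟨k₃, h₃⟩, ⟨k₄, h₄⟩⟩ := hc (0, 1)
    simp only [cross, one_mul, zero_mul, sub_zero, zero_sub, mul_one, mul_zero] at h₁ h₂ h₃ h₄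
    have : D * 1 = D * (D * (k₄ * k₁ - k₂ * k₃)) := by
      have ha2 : a.2 = -(D * k₂) := by linarith
      have hb1 : b.1 = -(D * k₃) := by linarith
      rw [h₄, h₁, ha2, hb1] at hD'
      linarith
    have := mul_left_cancel₀ hD0.ne' this
    have := Int.eq_one_of_mul_eq_one_right hD0.le this.symm
    omega
  set α := cross e b % D with hα
  set β := cross a e % D with hβ
  have hα0 : 0 ≤ α := Int.emod_nonneg _ hD0.ne'
  have hβ0 : 0 ≤ β := Int.emod_nonneg _ hD0.ne'
  have hα1 : α < D := Int.emod_lt_of_pos _ hD0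
  have hβ1 : β < D := Int.emod_lt_of_pos _ hD0
  have hαβ : 0 < α + β := by
    by_contra! hc
    exact he ⟨Int.dvd_of_emod_eq_zero (by omega), Int.dvd_of_emod_eq_zero (by omega)⟩
  have eα : α = cross e b - D * (cross e b / D) := by rw [hα, Int.emod_def]
  have eβ : β = cross a e - D * (cross a e / D) := by rw [hβ, Int.emod_def]
  have hq1 : D * (e.1 - (cross e b / D) * a.1 - (cross a e / D) * b.1) = α * a.1 + β * b.1 := by
    rw [eα, eβ]
    simp only [cross] at *
    linear_combination e.1 * hD'
  have hq2 : D * (e.2 - (cross e b / D) * a.2 - (cross a e / D) * b.2) = α * a.2 + β * b.2 := by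
    rw [eα, eβ]
    simp only [cross] at *
    linear_combination e.2 * hD'
  generalize e.1 - (cross e b / D) * a.1 - (cross a e / D) * b.1 = q₁ at hq1
  generalize e.2 - (cross e b / D) * a.2 - (cross a e / D) * b.2 = q₂ at hq2
  clear_value α β
  by_cases hle : α + β ≤ D
  · exact ⟨(q₁, q₂), α, β, hα0, hβ0, hα1, hβ1, hle, hαβ, hq1, hq2⟩
  · refine ⟨(a.1 + b.1 - q₁, a.2 + b.2 - q₂), D - α, D - β, by omega, by omega, by omega,
      by omega, by omega, by omega, ?_, ?_⟩ <;> linarith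

/-- A lattice point q of the triangle 0, a, b can replace a or b, according to the side of the line
through c on which it lies. The sum of determinants is twice the area. -/
theorem exists_smaller_triangle {I : Set (ℤ × ℤ)} (hI : StarClosed I) (hN : NoAntipodes I)
    {a b c : ℤ × ℤ} (ha : a ∈ I) (hb : b ∈ I) (hc : c ∈ I) (hab : 2 ≤ cross a b)
    (hbc : 0 < cross b c) (hca : 0 < cross c a) :
    ∃ a' ∈ I, ∃ b' ∈ I, ∃ c' ∈ I, 0 < cross a' b' ∧ 0 < cross b' c' ∧ 0 < cross c' a' ∧
      cross a' b' + cross b' c' + cross c' a' < cross a b + cross b c + cross c a := by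
  obtain ⟨q, α, β, hα0, hβ0, hα1, hβ1, hαβ, hpos, hq1, hq2⟩ := exists_small_combination hab
  have hqI : q ∈ I := hI.2 a ha b hb q α β _ hα0 hβ0 hαβ (by omega) hq1 hq2
  set D := cross a b with hD
  set X := cross b c with hX
  set Y := cross c a with hY
  have hD0 : 0 < D := by omega
  have hqb : cross q b = α := by
    refine mul_left_cancel₀ hD0.ne' ?_
    simp only [cross] at *
    linear_combination b.2 * hq1 - b.1 * hq2 - α * hD
  have haq : cross a q = β := by
    refine mul_left_cancel₀ hD0.ne' ?_
    simp only [cross] at *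
    linear_combination a.1 * hq2 - a.2 * hq1 - β * hD
  have hcq : D * cross c q = α * Y - β * X := by
    rw [hY, hX]
    simp only [cross] at *
    linear_combination c.1 * hq2 - c.2 * hq1
  have hqc : cross q c = - cross c q := by simp only [cross]; ring
  rcases lt_trichotomy (cross c q) 0 with hδ | hδ | hδ
  · refine ⟨a, ha, q, hqI, c, hc, ?_, by omega, hca, ?_⟩
    · rw [haq]
      rcases hβ0.eq_or_lt with h | h
      · exfalso; rw [← h] at hcq; nlinarith
      · exact h
    · have : D * (-cross c q) < D * X := by nlinarith
      have := lt_of_mul_lt_mul_left this hD0.le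
      omega
  -- If q were on the line through c, it would be a positive multiple of -c.
  · exfalso
    rw [hδ, mul_zero] at hcq
    have hα : 0 < α := by
      rcases hα0.eq_or_lt with h | h
      · have : 0 < β := by omega
        rw [← h] at hcq; nlinarith
      · exact h
    have e1 : D * (X * q.1) = D * (-(α * c.1)) := by
      have : X * a.1 + Y * b.1 + D * c.1 = 0 := by rw [hX, hY, hD]; simp only [cross]; ring
      linear_combination X * hq1 + b.1 * hcq + α * this
    have e2 : D * (X * q.2) = D * (-(α * c.2)) := by
      have : X * a.2 + Y * b.2 + D * c.2 = 0 := by rw [hX, hY, hD]; simp only [cross]; ring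
      linear_combination X * hq2 + b.2 * hcq + α * this
    have e1 := mul_left_cancel₀ hD0.ne' e1
    have e2 := mul_left_cancel₀ hD0.ne' e2
    have hge := hN.not_antiparallel hI hc hqI hδ
    have hc0 : 0 < c.1 ^ 2 + c.2 ^ 2 := by
      by_contra! hc0
      have h1 : c.1 = 0 := by nlinarith [sq_nonneg c.1, sq_nonneg c.2]
      have h2 : c.2 = 0 := by nlinarith [sq_nonneg c.1, sq_nonneg c.2]
      rw [hY] at hca
      simp [cross, h1, h2] at hca
    have : X * (c.1 * q.1 + c.2 * q.2) = -(α * (c.1 ^ 2 + c.2 ^ 2)) := by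
      linear_combination c.1 * e1 + c.2 * e2
    have h3 : 0 ≤ X * (c.1 * q.1 + c.2 * q.2) := mul_nonneg hbc.le hge
    have h4 : 0 < α * (c.1 ^ 2 + c.2 ^ 2) := mul_pos hα hc0
    linarith
  · refine ⟨q, hqI, b, hb, c, hc, ?_, hbc, hδ, ?_⟩
    · rw [hqb]
      rcases hα0.eq_or_lt with h | h
      · exfalso; rw [← h] at hcq; nlinarith
      · exact h
    · have : D * (cross c q) < D * Y := by nlinarith
      have := lt_of_mul_lt_mul_left this hD0.le
      omega

/-- Descent on twice the area; when all three determinants are 1, the identity for three plane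
vectors forces a + b + c = 0. -/
theorem exists_unimodularTriple {I : Set (ℤ × ℤ)} (hI : StarClosed I) (hN : NoAntipodes I)
    {a b c : ℤ × ℤ} (ha : a ∈ I) (hb : b ∈ I) (hc : c ∈ I) (hab : 0 < cross a b)
    (hbc : 0 < cross b c) (hca : 0 < cross c a) : ∃ a b, UnimodularTriple I a b := by
  obtain ⟨n, hn⟩ : ∃ n : ℕ, cross a b + cross b c + cross c a = n :=
    ⟨(cross a b + cross b c + cross c a).toNat, by omega⟩
  induction n using Nat.strong_induction_on generalizing a b c with
  | _ n ih =>
    have key : ∀ a' ∈ I, ∀ b' ∈ I, ∀ c' ∈ I, 0 < cross a' b' → 0 < cross b' c' →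
        0 < cross c' a' → cross a' b' + cross b' c' + cross c' a' < n →
        ∃ a b, UnimodularTriple I a b := fun a' ha' b' hb' c' hc' h1 h2 h3 h4 =>
      ih (cross a' b' + cross b' c' + cross c' a').toNat (by omega) ha' hb' hc' h1 h2 h3
        (by omega)
    by_cases h1 : 2 ≤ cross a b
    · obtain ⟨a', ha', b', hb', c', hc', h⟩ := exists_smaller_triangle hI hN ha hb hc h1 hbc hca
      exact key a' ha' b' hb' c' hc' h.1 h.2.1 h.2.2.1 (by omega)
    by_cases h2 : 2 ≤ cross b c
    · obtain ⟨a', ha', b', hb', c', hc', h⟩ := exists_smaller_triangle hI hN hb hc ha h2 hca hab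
      exact key a' ha' b' hb' c' hc' h.1 h.2.1 h.2.2.1 (by omega)
    by_cases h3 : 2 ≤ cross c a
    · obtain ⟨a', ha', b', hb', c', hc', h⟩ := exists_smaller_triangle hI hN hc ha hb h3 hab hbc
      exact key a' ha' b' hb' c' hc' h.1 h.2.1 h.2.2.1 (by omega)
    have hab1 : cross a b = 1 := by omega
    have hbc1 : cross b c = 1 := by omega
    have hca1 : cross c a = 1 := by omega
    have hc' : -(a + b) = c := by
      simp only [cross] at hab1 hbc1 hca1
      ext
      · simp only [Prod.fst_neg, Prod.fst_add]
        linear_combination a.1 * hbc1 + b.1 * hca1 + c.1 * hab1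
      · simp only [Prod.snd_neg, Prod.snd_add]
        linear_combination a.2 * hbc1 + b.2 * hca1 + c.2 * hab1
    exact ⟨a, b, ha, hb, hc' ▸ hc, hab1⟩

/-- If x ≤ y, then a + b = (v + (y - x)a) / y, and the coefficients have sum at most 1 because x ≥
1; symmetrically otherwise. -/
theorem StarClosed.add_mem_of_cone {J : Set (ℤ × ℤ)} (hJ : StarClosed J) {a b v : ℤ × ℤ}
    {x y : ℤ} (ha : a ∈ J) (hb : b ∈ J) (hv : v ∈ J) (hx : 0 < x) (hy : 0 < y)
    (h : v = x • a + y • b) : a + b ∈ J := by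
  subst h
  rcases le_total x y with hxy | hxy
  · refine hJ.2 _ hv _ ha _ 1 (y - x) y (by omega) (by omega) (by omega) hy ?_ ?_ <;>
      simp <;> ring
  · refine hJ.2 _ hv _ hb _ 1 (x - y) x (by omega) (by omega) (by omega) hx ?_ ?_ <;>
      simp <;> ring

theorem StarClosed.mem_ray_or_add_mem {J : Set (ℤ × ℤ)} (hJ : StarClosed J) {a b v : ℤ × ℤ}
    {x y : ℤ} (ha : a ∈ J) (hb : b ∈ J) (hv : v ∈ J) (hx : 0 ≤ x) (hy : 0 ≤ y) (hv0 : v ≠ 0)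
    (h : v = x • a + y • b) : (∃ m : ℤ, 1 ≤ m ∧ (v = m • a ∨ v = m • b)) ∨ a + b ∈ J := by
  rcases hx.eq_or_lt with rfl | hx
  · rcases hy.eq_or_lt with rfl | hy
    · simp at h; contradiction
    · exact Or.inl ⟨y, hy, Or.inr (by simpa using h)⟩
  · rcases hy.eq_or_lt with rfl | hy
    · exact Or.inl ⟨x, hx, Or.inl (by simpa using h)⟩
    · exact Or.inr (hJ.add_mem_of_cone ha hb hv hx hy h)

/-- The three cones spanned by pairs from a, b, -(a + b) cover the plane. A point strictly inside a
cone forces the sum of its generators, which is the negative of the third vector. -/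
theorem UnimodularTriple.cone_cases {J : Set (ℤ × ℤ)} (hJ : StarClosed J) {a b v : ℤ × ℤ}
    (h : UnimodularTriple J a b) (hv : v ∈ J) (hv0 : v ≠ 0) :
    (∃ m : ℤ, 1 ≤ m ∧ (v = m • a ∨ v = m • b ∨ v = m • (-(a + b)))) ∨
      (a + b ∈ J ∨ -a ∈ J ∨ -b ∈ J) := by
  obtain ⟨ha, hb, hc, hab⟩ := h
  set x := cross v b with hx
  set y := cross a v with hy
  have hvxy : v = x • a + y • b := by
    ext
    · simp only [cross, Prod.fst_add, Prod.smul_fst, smul_eq_mul] at *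
      rw [hx, hy]; linear_combination (-v.1) * hab
    · simp only [cross, Prod.snd_add, Prod.smul_snd, smul_eq_mul] at *
      rw [hx, hy]; linear_combination (-v.2) * hab
  clear_value x y
  by_cases h0 : 0 ≤ x ∧ 0 ≤ y
  · rcases StarClosed.mem_ray_or_add_mem hJ ha hb hv h0.1 h0.2 hv0 hvxy with ⟨m, hm, h⟩ | h
    · exact Or.inl ⟨m, hm, by tauto⟩
    · exact Or.inr (Or.inl h)
  · rcases le_total x y with hxy | hxy
    · have e : v = (y - x) • b + (-x) • (-(a + b)) := by rw [hvxy]; module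
      rcases StarClosed.mem_ray_or_add_mem hJ hb hc hv (by omega) (by omega) hv0 e with
        ⟨m, hm, h⟩ | h
      · exact Or.inl ⟨m, hm, by tauto⟩
      · right; right; left; convert h using 1; abel
    · have e : v = (x - y) • a + (-y) • (-(a + b)) := by rw [hvxy]; module
      rcases StarClosed.mem_ray_or_add_mem hJ ha hc hv (by omega) (by omega) hv0 e with
        ⟨m, hm, h⟩ | h
      · exact Or.inl ⟨m, hm, by tauto⟩
      · right; right; right; convert h using 1; abel

theorem UnimodularTriple.ne_zero {I : Set (ℤ × ℤ)} {a b : ℤ × ℤ} (h : UnimodularTriple I a b) :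
    a ≠ 0 := by
  rintro rfl
  have := h.2.2.2
  simp [cross] at this

theorem UnimodularTriple.neg_notMem {I : Set (ℤ × ℤ)} (hN : NoAntipodes I) {a b : ℤ × ℤ}
    (h : UnimodularTriple I a b) : a + b ∉ I ∧ -a ∉ I ∧ -b ∉ I :=
  ⟨fun hc => h.rotate.rotate.ne_zero (hN _ h.2.2.1 (by simpa using hc)),
    fun hc => h.ne_zero (hN _ h.1 hc), fun hc => h.rotate.ne_zero (hN _ h.2.1 hc)⟩

theorem UnimodularTriple.eq_smul {I : Set (ℤ × ℤ)} (hI : StarClosed I) (hN : NoAntipodes I)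
    {a b v : ℤ × ℤ} (h : UnimodularTriple I a b) (hv : v ∈ I) (hv0 : v ≠ 0) :
    ∃ m : ℤ, 1 ≤ m ∧ (v = m • a ∨ v = m • b ∨ v = m • (-(a + b))) := by
  have := h.neg_notMem hN
  rcases h.cone_cases hI hv hv0 with h | h
  · exact h
  · tauto

theorem StarClosed.add_mem_of_two_smul {I : Set (ℤ × ℤ)} (hI : StarClosed I) {a b : ℤ × ℤ}
    (ha : (2 : ℤ) • a ∈ I) (hb : (2 : ℤ) • b ∈ I) : a + b ∈ I := by
  refine hI.2 _ ha _ hb _ 1 1 2 (by omega) (by omega) (by omega) (by omega) ?_ ?_ <;>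
    simp <;> ring

/-- The shape of an antipode-free star closed set around a unimodular triple. -/
theorem UnimodularTriple.exists_shape {I : Set (ℤ × ℤ)} (hI : StarClosed I) (hN : NoAntipodes I)
    {a b : ℤ × ℤ} (h : UnimodularTriple I a b) :
    ∃ a b, UnimodularTriple I a b ∧
      ∀ v ∈ I, v = b ∨ v = -(a + b) ∨ ∃ m : ℤ, 0 ≤ m ∧ v = m • a := by
  have two : ∀ {m : ℤ} {u : ℤ × ℤ}, 1 ≤ m → m • u ∈ I → m = 1 ∨ (2 : ℤ) • u ∈ I :=
    fun {m u} hm hu => by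
      rcases hm.eq_or_lt with h | h
      · exact Or.inl h.symm
      · exact Or.inr (hI.smul_mem (by omega) (by omega) (by omega) hu)
  have main : ∀ a b, UnimodularTriple I a b → (2 : ℤ) • b ∉ I →
      (2 : ℤ) • (-(a + b)) ∉ I → ∀ v ∈ I, v = b ∨ v = -(a + b) ∨ ∃ m : ℤ, 0 ≤ m ∧ v = m • a := by
    intro a b h hb hc v hv
    by_cases hv0 : v = 0
    · exact Or.inr (Or.inr ⟨0, le_rfl, by simpa using hv0⟩)
    obtain ⟨m, hm, h1 | h1 | h1⟩ := h.eq_smul hI hN hv hv0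
    · exact Or.inr (Or.inr ⟨m, by omega, h1⟩)
    · rcases two hm (h1 ▸ hv) with rfl | h2
      · exact Or.inl (by simpa using h1)
      · exact absurd h2 hb
    · rcases two hm (h1 ▸ hv) with rfl | h2
      · exact Or.inr (Or.inl (by simpa using h1))
      · exact absurd h2 hc
  -- Two rays cannot both be long: the midpoint of 2a and 2b is a + b, the antipode of the third
  -- vector.
  have excl : ∀ a b, UnimodularTriple I a b → (2 : ℤ) • a ∈ I → (2 : ℤ) • b ∉ I :=
    fun a b h ha hb => (h.neg_notMem hN).1 (hI.add_mem_of_two_smul ha hb)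
  have e : -(b + -(a + b)) = a := by abel
  by_cases ha : (2 : ℤ) • a ∈ I
  · exact ⟨a, b, h, main a b h (excl a b h ha) fun hc =>
      excl _ _ h.rotate.rotate hc (by rwa [e])⟩
  by_cases hb : (2 : ℤ) • b ∈ I
  · exact ⟨_, _, h.rotate, main _ _ h.rotate (excl _ _ h.rotate hb) (by rwa [e])⟩
  · refine ⟨_, _, h.rotate.rotate, main _ _ h.rotate.rotate (by rwa [e]) ?_⟩
    convert hb using 2; abel

theorem UnimodularTriple.exists_shape_of_finite {I : Set (ℤ × ℤ)} (hI : StarClosed I)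
    (hN : NoAntipodes I) (hf : I.Finite) {a b : ℤ × ℤ} (h : UnimodularTriple I a b) :
    ∃ a b, ∃ k : ℕ, 1 ≤ k ∧ UnimodularTriple I a b ∧ (k : ℤ) • a ∈ I ∧
      ∀ v ∈ I, v = b ∨ v = -(a + b) ∨ ∃ m : ℕ, m ≤ k ∧ v = (m : ℤ) • a := by
  obtain ⟨a, b, h, hv⟩ := h.exists_shape hI hN
  have hinj : Function.Injective fun m : ℕ => (m : ℤ) • a := fun m m' hm => by
    have := smul_left_injective ℤ h.ne_zero hm
    exact_mod_cast this
  have hfin : {m : ℕ | (m : ℤ) • a ∈ I}.Finite := hf.preimage hinj.injOn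
  have h1 : 1 ∈ {m : ℕ | (m : ℤ) • a ∈ I} := by simpa using h.1
  obtain ⟨k, hk⟩ := hfin.exists_maximal ⟨1, h1⟩
  have hmax : ∀ m : ℕ, (m : ℤ) • a ∈ I → m ≤ k := fun m hm => by
    by_contra! hc
    exact absurd (hk.2 hm hc.le) (by omega)
  refine ⟨a, b, k, hmax 1 h1, h, hk.1, fun v hvI => ?_⟩
  rcases hv v hvI with h | h | ⟨m, hm, rfl⟩
  · exact Or.inl h
  · exact Or.inr (Or.inl h)
  · lift m to ℕ using hm
    exact Or.inr (Or.inr ⟨m, hmax m hvI, rfl⟩)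

/-- A point added to an antipode-free star closed set is a sum of three points, with one
exception. -/
theorem UnimodularTriple.sum_three_of_insert {I J : Set (ℤ × ℤ)} (hI : StarClosed I)
    (hN : NoAntipodes I) (hJ : StarClosed J) {a b v : ℤ × ℤ} (h : UnimodularTriple I a b)
    (hIJ : J = insert v I) (hv : v ∉ I) :
    (∃ y₁ ∈ J, ∃ y₂ ∈ J, ∃ y₃ ∈ J, y₁ ≠ y₂ ∧ y₁ ≠ y₃ ∧ y₂ ≠ y₃ ∧ y₁ + y₂ + y₃ = v) ∨
    ∃ a b, cross a b = 1 ∧ v = (2 : ℤ) • a ∧ J = {0, a, b, -(a + b), (2 : ℤ) • a} := by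
  have hsub : I ⊆ J := hIJ ▸ Set.subset_insert v I
  have hvJ : v ∈ J := hIJ ▸ Set.mem_insert v I
  have hJv : ∀ u ∈ J, u ∉ I → u = v := fun u hu hu' => by
    rw [hIJ] at hu; exact hu.resolve_right hu'
  have h0I : (0 : ℤ × ℤ) ∈ I := hI.1
  have h0 : (0 : ℤ × ℤ) ∈ J := hJ.1
  have hv0 : v ≠ 0 := by rintro rfl; exact hv hI.1
  -- Absence of antipodes keeps a + b out of I, so if it lies in J it is the new point, and v = a +
  -- b + 0.
  have sum_case : ∀ a b, UnimodularTriple I a b → a + b ∈ J →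
      ∃ y₁ ∈ J, ∃ y₂ ∈ J, ∃ y₃ ∈ J, y₁ ≠ y₂ ∧ y₁ ≠ y₃ ∧ y₂ ≠ y₃ ∧ y₁ + y₂ + y₃ = v := by
    intro a b h hab
    refine ⟨a, hsub h.1, b, hsub h.2.1, 0, h0, ?_, h.ne_zero, h.rotate.ne_zero, ?_⟩
    · rintro rfl
      have := h.2.2.2
      simp [cross, mul_comm] at this
    · rw [add_zero]; exact hJv _ hab (h.neg_notMem hN).1
  have ray_case : ∀ a b, UnimodularTriple I a b → ∀ m : ℤ, 1 ≤ m → v = m • a →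
      (∃ y₁ ∈ J, ∃ y₂ ∈ J, ∃ y₃ ∈ J, y₁ ≠ y₂ ∧ y₁ ≠ y₃ ∧ y₂ ≠ y₃ ∧ y₁ + y₂ + y₃ = v) ∨
      ∃ a b, cross a b = 1 ∧ v = (2 : ℤ) • a ∧ J = {0, a, b, -(a + b), (2 : ℤ) • a} := by
    intro a b h m hm hma
    have hm1 : m ≠ 1 := by rintro rfl; rw [one_smul] at hma; exact hv (hma ▸ h.1)
    have e : -(b + -(a + b)) = a := by abel
    by_cases hm2 : m = 2
    · subst hm2
      have h2a : (2 : ℤ) • a ∈ J := hma ▸ hvJ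
      -- For v = 2a, any further point of I puts the double of some triple vector in I: 2a is
      -- excluded as v is new, and the other two reduce to `sum_case`. With no further point, J is
      -- the five-point exception.
      by_cases hw : ∀ w ∈ I, w = 0 ∨ w = a ∨ w = b ∨ w = -(a + b)
      · refine Or.inr ⟨a, b, h.2.2.2, hma, ?_⟩
        ext u
        simp only [Set.mem_insert_iff, Set.mem_singleton_iff]
        constructor
        · intro hu
          rw [hIJ] at hu
          rcases hu with hu | hu
          · rw [← hma]; tauto
          · have := hw u hu; tauto
        · rintro (rfl | rfl | rfl | rfl | rfl)
          · exact h0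
          · exact hsub h.1
          · exact hsub h.2.1
          · exact hsub h.2.2.1
          · exact h2a
      · push Not at hw
        obtain ⟨w, hwI, hw0, hwa, hwb, hwc⟩ := hw
        obtain ⟨k, hk, hwk⟩ := h.eq_smul hI hN hwI hw0
        have hk2 : 2 ≤ k := by
          by_contra! hc
          obtain rfl : k = 1 := by omega
          simp only [one_smul] at hwk
          tauto
        have two : ∀ u : ℤ × ℤ, w = k • u → (2 : ℤ) • u ∈ I := fun u hu =>
          hI.smul_mem (by omega) hk2 (by omega) (hu ▸ hwI)
        rcases hwk with hwk | hwk | hwk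
        · exact absurd (hma ▸ two a hwk) hv
        · exact Or.inl (sum_case a b h (hJ.add_mem_of_two_smul h2a (hsub (two b hwk))))
        · refine Or.inl (sum_case _ _ h.rotate.rotate ?_)
          rw [e]
          exact hJ.add_mem_of_two_smul (hsub (two _ hwk)) h2a
    · left
      -- Here m ≥ 3, so a, (m - 1)a and 0 are distinct.
      refine ⟨a, hsub h.1, (m - 1) • a, ?_, 0, h0, ?_, h.ne_zero, ?_, ?_⟩
      · exact hJ.smul_mem (n := m) (by omega) (by omega) (by omega) (hma ▸ hvJ)
      · intro hc
        have : (1 : ℤ) • a = (m - 1) • a := by rwa [one_smul]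
        have := smul_left_injective ℤ h.ne_zero this
        omega
      · rw [Ne, smul_eq_zero]
        rintro (hc | hc)
        · omega
        · exact h.ne_zero hc
      · rw [hma]; module
  have e : -(b + -(a + b)) = a := by abel
  rcases (h.mono hsub).cone_cases hJ hvJ hv0 with ⟨m, hm, h1 | h1 | h1⟩ | h1 | h1 | h1
  · exact ray_case a b h m hm h1
  · exact ray_case _ _ h.rotate m hm h1
  · exact ray_case _ _ h.rotate.rotate m hm h1
  · exact Or.inl (sum_case a b h h1)
  · refine Or.inl (sum_case _ _ h.rotate ?_)
    convert h1 using 1; abel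
  · refine Or.inl (sum_case _ _ h.rotate.rotate ?_)
    convert h1 using 1; abel

/-! ### Vertices and integer coordinates around a point. -/

/-- V consists of the extreme points of the hull; they span it by the Krein–Milman theorem. -/
theorem exists_vertices {n : ℕ} (S : Finset (Fin n → ℝ)) :
    ∃ V : Finset (Fin n → ℝ), V ⊆ S ∧ (S.Nonempty → V.Nonempty) ∧
      (S : Set (Fin n → ℝ)) ⊆ convexHull ℝ (V : Set (Fin n → ℝ)) ∧
      ∀ v ∈ V, v ∉ convexHull ℝ ((S : Set (Fin n → ℝ)) \ {v}) := by
  set E := (convexHull ℝ (S : Set (Fin n → ℝ))).extremePoints ℝ with hE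
  have hES : E ⊆ S := extremePoints_convexHull_subset (𝕜 := ℝ)
  have hEf : E.Finite := S.finite_toSet.subset hES
  have hconv : convexHull ℝ E = convexHull ℝ (S : Set (Fin n → ℝ)) := by
    rw [← (hEf.isClosed_convexHull (𝕜 := ℝ)).closure_eq]
    exact closure_convexHull_extremePoints (S.finite_toSet.isCompact_convexHull ℝ)
      (convex_convexHull ℝ _)
  have hsub : (S : Set (Fin n → ℝ)) ⊆ convexHull ℝ E := hconv ▸ subset_convexHull ℝ _
  refine ⟨hEf.toFinset, by simpa [← Finset.coe_subset] using hES, ?_, by simpa using hsub, ?_⟩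
  · rintro ⟨s, hs⟩
    rw [Set.Finite.toFinset_nonempty, ← convexHull_nonempty_iff (𝕜 := ℝ)]
    exact ⟨s, hsub hs⟩
  · intro v hv hc
    rw [Set.Finite.mem_toFinset, hE,
      (convex_convexHull ℝ _).mem_extremePoints_iff_mem_sdiff_convexHull_sdiff] at hv
    exact hv.2 (convexHull_mono (Set.sdiff_subset_sdiff_left (subset_convexHull ℝ _)) hc)

theorem LatticeSaturated.erase {n : ℕ} {S : Finset (Fin n → ℝ)} (hS : LatticeSaturated S)
    {v : Fin n → ℝ} (hv : v ∉ convexHull ℝ ((S : Set (Fin n → ℝ)) \ {v})) :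
    LatticeSaturated (S.erase v) := by
  rw [LatticeSaturated, Finset.coe_erase]
  refine ⟨Set.sdiff_subset.trans hS.1, fun x hx hxc => Finset.mem_erase.2 ⟨?_, ?_⟩⟩
  · rintro rfl; exact hv hxc
  · exact hS.2 x hx (convexHull_mono Set.sdiff_subset hxc)

/-- The point with integer coordinates `z` relative to the origin `o`. -/
def pointAt (o : Fin 2 → ℝ) (z : ℤ × ℤ) : Fin 2 → ℝ := ![o 0 + z.1, o 1 + z.2]

@[simp] theorem pointAt_zero_apply (o : Fin 2 → ℝ) (z : ℤ × ℤ) : pointAt o z 0 = o 0 + z.1 := rfl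

@[simp] theorem pointAt_one_apply (o : Fin 2 → ℝ) (z : ℤ × ℤ) : pointAt o z 1 = o 1 + z.2 := rfl

theorem pointAt_zero (o : Fin 2 → ℝ) : pointAt o 0 = o := by
  ext i; fin_cases i <;> simp

theorem pointAt_injective (o : Fin 2 → ℝ) : Function.Injective (pointAt o) := fun z z' h => by
  have h0 := congrFun h 0
  have h1 := congrFun h 1
  simp only [pointAt_zero_apply, pointAt_one_apply, add_right_inj, Int.cast_inj] at h0 h1
  exact Prod.ext h0 h1

theorem pointAt_mem_latticePoints {o : Fin 2 → ℝ} (ho : o ∈ latticePoints 2) (z : ℤ × ℤ) :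
    pointAt o z ∈ latticePoints 2 := by
  obtain ⟨a, ha⟩ := ho 0
  obtain ⟨b, hb⟩ := ho 1
  intro i
  fin_cases i
  · exact ⟨a + z.1, by simp [ha]⟩
  · exact ⟨b + z.2, by simp [hb]⟩

theorem exists_pointAt_eq {o x : Fin 2 → ℝ} (ho : o ∈ latticePoints 2)
    (hx : x ∈ latticePoints 2) : ∃ z, pointAt o z = x := by
  have h := sub_mem_latticePoints hx ho
  obtain ⟨a, ha⟩ := h 0
  obtain ⟨b, hb⟩ := h 1
  refine ⟨(a, b), ?_⟩
  ext i
  fin_cases i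
  · simp [← ha]
  · simp [← hb]

/-- The points of `S` in integer coordinates relative to the origin `o`. -/
def relativePoints (S : Finset (Fin 2 → ℝ)) (o : Fin 2 → ℝ) : Set (ℤ × ℤ) :=
  {z | pointAt o z ∈ S}

theorem LatticeSaturated.starClosed {S : Finset (Fin 2 → ℝ)} (hS : LatticeSaturated S)
    {o : Fin 2 → ℝ} (ho : o ∈ S) : StarClosed (relativePoints S o) := by
  have h0 : ((0, 0) : ℤ × ℤ) ∈ relativePoints S o := by
    change pointAt o 0 ∈ S
    rwa [pointAt_zero]
  refine ⟨h0, fun u hu v hv q α β D hα hβ hαβ hD h1 h2 =>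
    hS.2 _ (pointAt_mem_latticePoints (hS.1 ho) q) ?_⟩
  have hD' : (0 : ℝ) < D := by exact_mod_cast hD
  have hα' : (0 : ℝ) ≤ α := by exact_mod_cast hα
  have hβ' : (0 : ℝ) ≤ β := by exact_mod_cast hβ
  have hαβ' : (α + β : ℝ) ≤ D := by exact_mod_cast hαβ
  have h1' : (D * q.1 : ℝ) = α * u.1 + β * v.1 := by exact_mod_cast h1
  have h2' : (D * q.2 : ℝ) = α * u.2 + β * v.2 := by exact_mod_cast h2
  have key := (convex_convexHull ℝ (S : Set (Fin 2 → ℝ))).sum_mem (t := Finset.univ)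
    (w := ![((D : ℝ) - α - β) / D, (α : ℝ) / D, (β : ℝ) / D]) (z := ![o, pointAt o u, pointAt o v])
    (by
      intro i _
      fin_cases i
      · exact div_nonneg (by linarith) hD'.le
      · exact div_nonneg hα' hD'.le
      · exact div_nonneg hβ' hD'.le)
    (by simp [Fin.sum_univ_three]; field_simp; ring)
    (by
      intro i _
      fin_cases i
      · exact subset_convexHull ℝ _ ho
      · exact subset_convexHull ℝ _ hu
      · exact subset_convexHull ℝ _ hv)
  convert key using 1
  ext i
  fin_cases i <;> simp [Fin.sum_univ_three] <;> field_simp <;> linarith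

theorem pointAt_add_pointAt (o : Fin 2 → ℝ) (u v : ℤ × ℤ) :
    pointAt o u + pointAt o v = pointAt o (u + v) + o := by
  ext i; fin_cases i <;> simp <;> ring

/-! ### Isolated centers. -/

theorem IsIsolatedCenter.noAntipodes {S : Finset (Fin 2 → ℝ)} {o : Fin 2 → ℝ}
    (h : IsIsolatedCenter S o) : NoAntipodes (relativePoints S o) := fun u hu hu' => by
  have := pointAt_injective o
    (h.2.2 _ hu _ hu' (by rw [pointAt_add_pointAt, add_neg_cancel, pointAt_zero]))
  have h1 := congrArg Prod.fst this
  have h2 := congrArg Prod.snd this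
  simp only [Prod.fst_neg, Prod.snd_neg] at h1 h2
  ext <;> simp <;> omega

/-- The determinants of consecutive pairs are proportional to t, r, s, so they share a sign. If they
vanish, pairing the relation with a contradicts `NoAntipodes.not_antiparallel`. -/
theorem exists_unimodularTriple_of_weights {I : Set (ℤ × ℤ)} (hI : StarClosed I)
    (hN : NoAntipodes I) {a b c : ℤ × ℤ} (ha : a ∈ I) (hb : b ∈ I) (hc : c ∈ I) (ha0 : a ≠ 0)
    {r s t : ℝ} (hr : 0 < r) (hs : 0 < s) (ht : 0 < t)
    (h1 : r * a.1 + s * b.1 + t * c.1 = 0) (h2 : r * a.2 + s * b.2 + t * c.2 = 0) :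
    ∃ a b, UnimodularTriple I a b := by
  have hcross : ∀ u v : ℤ × ℤ, (cross u v : ℝ) = u.1 * v.2 - u.2 * v.1 := fun u v => by
    simp [cross]
  have e1 : s * cross a b = t * cross c a := by
    rw [hcross, hcross]; linear_combination (a.1 : ℝ) * h2 - (a.2 : ℝ) * h1
  have e2 : r * cross a b = t * cross b c := by
    rw [hcross, hcross]; linear_combination (b.2 : ℝ) * h1 - (b.1 : ℝ) * h2
  have hneg : ∀ u v, cross v u = -cross u v := fun u v => by simp only [cross]; ring
  rcases lt_trichotomy (cross a b) 0 with h | h | h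
  · have h' : (cross a b : ℝ) < 0 := by exact_mod_cast h
    have h3 : (cross c a : ℝ) < 0 := by
      by_contra! hh; nlinarith [mul_nonneg ht.le hh, mul_pos hs (neg_pos.2 h')]
    have h4 : (cross b c : ℝ) < 0 := by
      by_contra! hh; nlinarith [mul_nonneg ht.le hh, mul_pos hr (neg_pos.2 h')]
    have h3 : cross c a < 0 := by exact_mod_cast h3
    have h4 : cross b c < 0 := by exact_mod_cast h4
    exact exists_unimodularTriple hI hN hb ha hc (by rw [hneg]; omega) (by rw [hneg]; omega)
      (by rw [hneg]; omega)
  · exfalso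
    rw [h, Int.cast_zero, mul_zero] at e1
    have h3 : cross c a = 0 := by
      have := (mul_eq_zero.1 e1.symm).resolve_left ht.ne'
      exact_mod_cast this
    have d1 := hN.not_antiparallel hI ha hb h
    have d2 := hN.not_antiparallel hI ha hc (by rw [hneg, h3, neg_zero])
    have d1 : (0 : ℝ) ≤ a.1 * b.1 + a.2 * b.2 := by exact_mod_cast d1
    have d2 : (0 : ℝ) ≤ a.1 * c.1 + a.2 * c.2 := by exact_mod_cast d2
    have hsum : r * ((a.1 : ℝ) ^ 2 + (a.2 : ℝ) ^ 2) + s * (a.1 * b.1 + a.2 * b.2) +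
        t * (a.1 * c.1 + a.2 * c.2) = 0 := by
      linear_combination (a.1 : ℝ) * h1 + (a.2 : ℝ) * h2
    have hle : (a.1 : ℝ) ^ 2 + (a.2 : ℝ) ^ 2 ≤ 0 := by
      by_contra! hh
      have := mul_pos hr hh
      have := mul_nonneg hs.le d1
      have := mul_nonneg ht.le d2
      linarith
    have z1 : (a.1 : ℝ) = 0 := by nlinarith [sq_nonneg (a.1 : ℝ), sq_nonneg (a.2 : ℝ)]
    have z2 : (a.2 : ℝ) = 0 := by nlinarith [sq_nonneg (a.1 : ℝ), sq_nonneg (a.2 : ℝ)]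
    exact ha0 (Prod.ext (by exact_mod_cast z1) (by exact_mod_cast z2))
  · have h' : (0 : ℝ) < cross a b := by exact_mod_cast h
    have h3 : (0 : ℝ) < cross c a := by
      by_contra! hh; nlinarith [mul_nonneg ht.le (neg_nonneg.2 hh), mul_pos hs h']
    have h4 : (0 : ℝ) < cross b c := by
      by_contra! hh; nlinarith [mul_nonneg ht.le (neg_nonneg.2 hh), mul_pos hr h']
    exact exists_unimodularTriple hI hN ha hb hc h (by exact_mod_cast h4) (by exact_mod_cast h3)

/-- Carathéodory's theorem writes o as a positive combination of at most three other points of S. -/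
theorem IsIsolatedCenter.exists_unimodularTriple {S : Finset (Fin 2 → ℝ)}
    (hS : LatticeSaturated S) {o : Fin 2 → ℝ} (h : IsIsolatedCenter S o) :
    ∃ a b, UnimodularTriple (relativePoints S o) a b := by
  have hI := hS.starClosed h.1
  have hN := h.noAntipodes
  obtain ⟨ι, _, z, w, hz, haff, hw, hw1, hsum⟩ := eq_pos_convex_span_of_mem_convexHull h.2.1
  have hcard : Fintype.card ι ≤ 3 := by
    refine haff.card_le_finrank_succ.trans ?_
    have := Submodule.finrank_le (vectorSpan ℝ (Set.range z))
    simp only [Module.finrank_fintype_fun_eq_card, Fintype.card_fin] at this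
    omega
  have hzS : ∀ i, z i ∈ S ∧ z i ≠ o := fun i => hz ⟨i, rfl⟩
  choose ζ hζ using fun i => exists_pointAt_eq (hS.1 h.1) (hS.1 (hzS i).1)
  have hζI : ∀ i, ζ i ∈ relativePoints S o := fun i => by
    change pointAt o (ζ i) ∈ S
    rw [hζ]; exact (hzS i).1
  have hζ0 : ∀ i, ζ i ≠ 0 := fun i hi => (hzS i).2 (by rw [← hζ, hi, pointAt_zero])
  have s1 : ∑ i, w i * (ζ i).1 = 0 := by
    have := congrFun hsum 0
    simp only [← hζ, Finset.sum_apply, Pi.smul_apply, pointAt_zero_apply, smul_eq_mul, mul_add,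
      Finset.sum_add_distrib] at this
    rw [← Finset.sum_mul, hw1] at this
    linarith
  have s2 : ∑ i, w i * (ζ i).2 = 0 := by
    have := congrFun hsum 1
    simp only [← hζ, Finset.sum_apply, Pi.smul_apply, pointAt_one_apply, smul_eq_mul, mul_add,
      Finset.sum_add_distrib] at this
    rw [← Finset.sum_mul, hw1] at this
    linarith
  obtain ⟨k, hk⟩ : ∃ k, k = Fintype.card ι := ⟨_, rfl⟩
  obtain e := (Fintype.equivFinOfCardEq hk.symm).symm
  rw [← hk] at hcard
  rw [← e.sum_comp] at s1 s2 hw1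
  interval_cases k
  · simp at hw1
  · rw [Fin.sum_univ_one] at s1 s2
    exact exists_unimodularTriple_of_weights hI hN (hζI (e 0)) (hζI (e 0)) (hζI (e 0)) (hζ0 _)
      (hw (e 0)) (hw (e 0)) (hw (e 0)) (by linarith) (by linarith)
  -- With fewer than three points one is repeated, here with its weight halved, and the degenerate
  -- case is excluded by the weighted lemma.
  · rw [Fin.sum_univ_two] at s1 s2
    exact exists_unimodularTriple_of_weights hI hN (hζI (e 0)) (hζI (e 1)) (hζI (e 1)) (hζ0 _)
      (hw (e 0)) (half_pos (hw (e 1))) (half_pos (hw (e 1))) (by linarith) (by linarith)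
  · rw [Fin.sum_univ_three] at s1 s2
    exact exists_unimodularTriple_of_weights hI hN (hζI (e 0)) (hζI (e 1)) (hζI (e 2)) (hζ0 _)
      (hw (e 0)) (hw (e 1)) (hw (e 2)) s1 s2

theorem card_eq_five_and_sum_eq {S : Finset (Fin 2 → ℝ)} (hS : LatticeSaturated S)
    {o : Fin 2 → ℝ} (ho : o ∈ S) {a b : ℤ × ℤ} (hab : cross a b = 1)
    (hJ : relativePoints S o = {0, a, b, -(a + b), (2 : ℤ) • a}) :
    S.card = 5 ∧ pointAt o ((2 : ℤ) • a) + (o + o) + (o + o) = ∑ s ∈ S, s := by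
  classical
  have hSi : S = Finset.image (pointAt o) {0, a, b, -(a + b), (2 : ℤ) • a} := by
    ext x
    constructor
    · intro hx
      obtain ⟨z, rfl⟩ := exists_pointAt_eq (hS.1 ho) (hS.1 hx)
      refine Finset.mem_image_of_mem _ ?_
      have : z ∈ relativePoints S o := hx
      rw [hJ] at this
      simpa using this
    · intro hx
      obtain ⟨z, hz, rfl⟩ := Finset.mem_image.1 hx
      have : z ∈ relativePoints S o := by rw [hJ]; simpa using hz
      exact this
  -- Coordinates in the basis a, b, used to tell the five vectors apart.
  let f : ℤ × ℤ → ℤ × ℤ := fun z => (cross z b, cross a z)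
  have hf0 : f 0 = (0, 0) := by simp [f, cross]
  have hfa : f a = (1, 0) := by simp only [f, hab]; simp [cross, mul_comm]
  have hfb : f b = (0, 1) := by simp only [f, hab]; simp [cross, mul_comm]
  have hfc : f (-(a + b)) = (-1, -1) := by
    simp only [f, cross, Prod.fst_neg, Prod.snd_neg, Prod.fst_add, Prod.snd_add, Prod.mk.injEq]
      at hab ⊢
    constructor <;> linarith
  have hf2 : f ((2 : ℤ) • a) = (2, 0) := by
    simp only [f, cross, Prod.smul_fst, Prod.smul_snd, smul_eq_mul, Prod.mk.injEq] at hab ⊢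
    constructor <;> linarith
  have hne : ∀ {u v : ℤ × ℤ}, f u ≠ f v → u ≠ v := fun h e => h (congrArg f e)
  have n0 : (0 : ℤ × ℤ) ∉ ({a, b, -(a + b), (2 : ℤ) • a} : Finset (ℤ × ℤ)) := by
    simp only [Finset.mem_insert, Finset.mem_singleton, not_or]
    refine ⟨hne ?_, hne ?_, hne ?_, hne ?_⟩ <;> simp only [hf0, hfa, hfb, hfc, hf2] <;> decide
  have n1 : a ∉ ({b, -(a + b), (2 : ℤ) • a} : Finset (ℤ × ℤ)) := by
    simp only [Finset.mem_insert, Finset.mem_singleton, not_or]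
    refine ⟨hne ?_, hne ?_, hne ?_⟩ <;> simp only [hfa, hfb, hfc, hf2] <;> decide
  have n2 : b ∉ ({-(a + b), (2 : ℤ) • a} : Finset (ℤ × ℤ)) := by
    simp only [Finset.mem_insert, Finset.mem_singleton, not_or]
    refine ⟨hne ?_, hne ?_⟩ <;> simp only [hfb, hfc, hf2] <;> decide
  have n3 : -(a + b) ≠ (2 : ℤ) • a := hne (by simp only [hfc, hf2]; decide)
  constructor
  · rw [hSi, Finset.card_image_of_injective _ (pointAt_injective o),
      Finset.card_insert_of_notMem n0, Finset.card_insert_of_notMem n1,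
      Finset.card_insert_of_notMem n2, Finset.card_pair n3]
  · rw [hSi, Finset.sum_image (pointAt_injective o).injOn, Finset.sum_insert n0,
      Finset.sum_insert n1, Finset.sum_insert n2, Finset.sum_pair n3]
    ext i
    fin_cases i <;> simp <;> ring

theorem IsIsolatedCenter.of_erase {n : ℕ} {S : Finset (Fin n → ℝ)} {v o : Fin n → ℝ}
    (h : IsIsolatedCenter (S.erase v) o) :
    o ∈ S ∧ o ∈ convexHull ℝ ((S : Set (Fin n → ℝ)) \ {o}) :=
  ⟨Finset.mem_of_mem_erase h.1, convexHull_mono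
    (Set.sdiff_subset_sdiff_left (by exact_mod_cast Finset.erase_subset v S)) h.2.1⟩

theorem IsIsolatedCenter.sum_three_of_erase {S : Finset (Fin 2 → ℝ)} (hS : LatticeSaturated S)
    {v o : Fin 2 → ℝ} (hv : v ∈ S) (hS' : LatticeSaturated (S.erase v))
    (h : IsIsolatedCenter (S.erase v) o) :
    v + (o + o) ∈ wedgePower 3 (S : Set (Fin 2 → ℝ)) ∨
      (S.card = 5 ∧ IsIsolatedCenter S o ∧ v + (o + o) + (o + o) = ∑ s ∈ S, s) := by
  classical
  obtain ⟨a₀, b₀, htriple⟩ := h.exists_unimodularTriple hS'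
  obtain ⟨ho, hoc⟩ := h.of_erase
  have hol := hS.1 ho
  obtain ⟨ζ, rfl⟩ := exists_pointAt_eq hol (hS.1 hv)
  have hJ : relativePoints S o = insert ζ (relativePoints (S.erase (pointAt o ζ)) o) := by
    ext z
    simp only [relativePoints, Set.mem_ofPred_eq, Set.mem_insert_iff, Finset.mem_erase]
    by_cases hz : z = ζ
    · simp [hz, hv]
    · simp [hz, (pointAt_injective o).ne hz]
  have hζ : ζ ∉ relativePoints (S.erase (pointAt o ζ)) o := by simp [relativePoints]
  rcases htriple.sum_three_of_insert (hS'.starClosed h.1) h.noAntipodes (hS.starClosed ho) hJ hζ with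
    ⟨y₁, h₁, y₂, h₂, y₃, h₃, h12, h13, h23, rfl⟩ | ⟨a, b, hab, rfl, hJ5⟩
  · left
    have := add_mem_wedgePower_three (S := (S : Set (Fin 2 → ℝ))) h₁ h₂ h₃
      ((pointAt_injective o).ne h12) ((pointAt_injective o).ne h13) ((pointAt_injective o).ne h23)
    convert this using 1
    rw [pointAt_add_pointAt, add_right_comm (pointAt _ _), pointAt_add_pointAt]
    abel
  · right
    obtain ⟨hc, hs⟩ := card_eq_five_and_sum_eq hS ho hab hJ5
    refine ⟨hc, ⟨ho, hoc, ?_⟩, hs⟩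
    -- In the exceptional configuration -2a is not a point, so putting 2a back creates no antipodes
    -- and o stays isolated.
    have hN : NoAntipodes (relativePoints S o) := by
      have hneg : -((2 : ℤ) • a) ∉ relativePoints S o := by
        rw [hJ5]
        simp only [Set.mem_insert_iff, Set.mem_singleton_iff, not_or]
        have hx : ∀ u, -((2 : ℤ) • a) = u → cross u b = -2 ∧ cross a u = 0 := by
          rintro _ rfl
          simp only [cross, Prod.fst_neg, Prod.snd_neg, Prod.smul_fst, Prod.smul_snd,
            smul_eq_mul] at hab ⊢
          constructor <;> linarith
        refine ⟨fun e => ?_, fun e => ?_, fun e => ?_, fun e => ?_, fun e => ?_⟩ <;>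
          have hx := hx _ e <;>
          simp only [cross, Prod.fst_neg, Prod.snd_neg, Prod.smul_fst, Prod.smul_snd,
            smul_eq_mul, Prod.fst_add, Prod.snd_add, Prod.fst_zero, Prod.snd_zero] at hx hab <;>
          linarith [hx.1, hx.2]
      intro u hu hu'
      have hu1 := hu
      have hu2 := hu'
      rw [hJ] at hu1 hu2
      rcases hu1 with rfl | hu1
      · exact absurd hu' hneg
      · rcases hu2 with hu2 | hu2
        · rw [neg_eq_iff_eq_neg.1 hu2] at hu
          exact absurd hu hneg
        · exact h.noAntipodes u hu1 hu2
    intro u hu w hw huw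
    obtain ⟨u, rfl⟩ := exists_pointAt_eq hol (hS.1 hu)
    obtain ⟨w, rfl⟩ := exists_pointAt_eq hol (hS.1 hw)
    rw [pointAt_add_pointAt, add_left_inj] at huw
    have huw : u + w = 0 := pointAt_injective o (by rw [huw, pointAt_zero])
    obtain rfl : w = -u := by rw [eq_neg_iff_add_eq_zero, add_comm]; exact huw
    rw [hN u hu hw, neg_zero]

/-! ### The induction on the number of lattice points. -/

/-- Both obstructions appear in the conclusion so that the statement is stable under complements and
survives deletion of a vertex of either weight. -/
theorem mem_wedgePower_or_center {S : Finset (Fin 2 → ℝ)} (hS : LatticeSaturated S) {p : ℕ}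
    {x : Fin 2 → ℝ} (hx : x ∈ latticePoints 2) {w : (Fin 2 → ℝ) → ℝ}
    (hw : IsFractionalSum S p x w) :
    x ∈ wedgePower p (S : Set (Fin 2 → ℝ)) ∨
      ∃ o, IsIsolatedCenter S o ∧
        ((p = 2 ∧ x = o + o) ∨ (p + 2 = S.card ∧ x + (o + o) = ∑ s ∈ S, s)) := by
  classical
  induction hn : S.card generalizing S p x w with
  | zero =>
    have hS0 := Finset.card_eq_zero.1 hn
    subst hS0
    have hp : p = 0 := by simpa using hw.le_card
    subst hp
    exact Or.inl ⟨∅, by simp, rfl, by simpa using hw.2.2⟩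
  | succ n ih =>
    obtain ⟨V, hVS, hVn, hconv, hV⟩ := exists_vertices S
    by_cases hint : ∀ w, IsFractionalSum S p x w → ∀ v ∈ V, 0 < w v ∧ w v < 1
    · rcases mem_wedgePower_or_center_of_interior hS hx hVS
        (hVn (Finset.card_pos.1 (by omega))) hconv hw hint with h | ⟨o, h, h2⟩
      · exact Or.inl h
      · exact Or.inr ⟨o, h, Or.inl h2⟩
    push Not at hint
    obtain ⟨w, hw, v, hv, hwv⟩ := hint
    have hvS := hVS hv
    have hS' := hS.erase (hV v hv)
    have hcard : (S.erase v).card = n := by rw [Finset.card_erase_of_mem hvS, hn]; rfl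
    have hsub : ((S.erase v : Finset _) : Set (Fin 2 → ℝ)) ⊆ S := by
      exact_mod_cast Finset.erase_subset v S
    have hsum : v + ∑ s ∈ S.erase v, s = ∑ s ∈ S, s := Finset.add_sum_erase S (fun s => s) hvS
    have hw01 : w v = 0 ∨ w v = 1 := by
      rcases (hw.1 v hvS).1.eq_or_lt with h | h
      · exact Or.inl h.symm
      · exact Or.inr (le_antisymm (hw.1 v hvS).2 (hwv h))
    rcases hw01 with hw0 | hw1
    · rcases ih hS' hx (hw.erase_of_eq_zero hvS hw0) hcard with h | ⟨o, h, ⟨rfl, rfl⟩ | ⟨h1, h2⟩⟩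
      · exact Or.inl (wedgePower_mono hsub h)
      · rcases two_nsmul_dichotomy h.of_erase.1 h.of_erase.2 with h' | h'
        · exact Or.inl h'
        · exact Or.inr ⟨o, h', Or.inl ⟨rfl, rfl⟩⟩
      -- Since v is unused, the complement of x in S is v + 2o, which should be a sum of three
      -- points. In the five-point exception p = 2 and x = 2o.
      · have hx' : v + (o + o) + x = ∑ s ∈ S, s := by rw [← hsum, ← h2]; abel
        rcases h.sum_three_of_erase hS hvS hS' with h3 | ⟨h5, ho, hs⟩
        · exact Or.inl (wedgePower_compl (by omega) hx' h3)
        · refine Or.inr ⟨o, ho, Or.inl ⟨by omega, ?_⟩⟩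
          exact add_left_cancel (hx'.trans hs.symm)
    · obtain ⟨q, rfl, hw'⟩ := hw.erase_of_eq_one hvS hw1
      rcases ih hS' (sub_mem_latticePoints hx (hS.1 hvS)) hw' hcard with
        h | ⟨o, h, ⟨rfl, h2⟩ | ⟨h1, h2⟩⟩
      · have := add_mem_wedgePower_succ hvS h
        rw [add_sub_cancel] at this
        exact Or.inl this
      · obtain rfl : x = v + (o + o) := by rw [← h2]; abel
        rcases h.sum_three_of_erase hS hvS hS' with h3 | ⟨h5, ho, hs⟩
        · exact Or.inl h3
        · exact Or.inr ⟨o, ho, Or.inr ⟨by omega, hs⟩⟩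
      · have hx' : x + (o + o) = ∑ s ∈ S, s := by rw [← hsum, ← h2]; abel
        rcases two_nsmul_dichotomy h.of_erase.1 h.of_erase.2 with h' | h'
        · exact Or.inl (wedgePower_compl (by omega) (by rw [add_comm]; exact hx') h')
        · exact Or.inr ⟨o, h', Or.inr ⟨by omega, hx'⟩⟩

/-! ### Recognising the exceptional triangles. -/

theorem mem_exceptionalTriangle {k m : ℕ} (hm : m ≤ k) :
    ![(m : ℝ), 0] ∈ exceptionalTriangle k := by
  have hm' : (m : ℝ) ≤ k := by exact_mod_cast hm
  have hD : (0 : ℝ) < 2 * k + 1 := by positivity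
  have key := (convex_convexHull ℝ {![-1, -1], ![0, 1], ![(k : ℝ), 0]}).sum_mem
    (t := Finset.univ)
    -- The second coordinate forces equal weights at (-1, -1) and (0, 1); total weight 1 and first
    -- coordinate m then determine them.
    (w := ![((k : ℝ) - m) / (2 * k + 1), ((k : ℝ) - m) / (2 * k + 1), (1 + 2 * m) / (2 * k + 1)])
    (z := ![![-1, -1], ![0, 1], ![(k : ℝ), 0]])
    (by
      intro i _
      fin_cases i
      · exact div_nonneg (by linarith) hD.le
      · exact div_nonneg (by linarith) hD.le
      · exact div_nonneg (by positivity) hD.le)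
    (by simp [Fin.sum_univ_three]; field_simp; ring)
    (by
      intro i _
      apply subset_convexHull ℝ
      fin_cases i <;> simp)
  rw [exceptionalTriangle]
  convert key using 1
  ext i
  fin_cases i <;> simp [Fin.sum_univ_three] <;> (field_simp; ring)

/-- The integral affine coordinates with origin `o` and basis `a, b`. -/
noncomputable def basisCoords (o : Fin 2 → ℝ) {a b : ℤ × ℤ} (hab : cross a b = 1) :
    (Fin 2 → ℝ) ≃ᵃ[ℝ] (Fin 2 → ℝ) :=
  (AffineEquiv.constVAdd ℝ (Fin 2 → ℝ) (-o)).trans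
    (LinearEquiv.toAffineEquiv
      { toFun := fun y => ![y 0 * b.2 - y 1 * b.1, a.1 * y 1 - a.2 * y 0]
        invFun := fun x => ![x 0 * a.1 + x 1 * b.1, x 0 * a.2 + x 1 * b.2]
        map_add' := fun x y => by ext i; fin_cases i <;> simp <;> ring
        map_smul' := fun c x => by ext i; fin_cases i <;> simp <;> ring
        left_inv := fun y => by
          have h : (a.1 * b.2 - a.2 * b.1 : ℝ) = 1 := by exact_mod_cast hab
          ext i
          fin_cases i
          · simp; linear_combination y 0 * h
          · simp; linear_combination y 1 * h
        right_inv := fun x => by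
          have h : (a.1 * b.2 - a.2 * b.1 : ℝ) = 1 := by exact_mod_cast hab
          ext i
          fin_cases i
          · simp; linear_combination x 0 * h
          · simp; linear_combination x 1 * h })

theorem basisCoords_pointAt (o : Fin 2 → ℝ) {a b : ℤ × ℤ} (hab : cross a b = 1) (z : ℤ × ℤ) :
    basisCoords o hab (pointAt o z) = ![(cross z b : ℝ), (cross a z : ℝ)] := by
  ext i
  fin_cases i <;> simp [basisCoords, cross]

theorem basisCoords_image_latticePoints {o : Fin 2 → ℝ} (ho : o ∈ latticePoints 2)
    {a b : ℤ × ℤ} (hab : cross a b = 1) :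
    basisCoords o hab '' latticePoints 2 = latticePoints 2 := by
  ext y
  constructor
  · rintro ⟨x, hx, rfl⟩
    obtain ⟨z, rfl⟩ := exists_pointAt_eq ho hx
    rw [basisCoords_pointAt]
    intro i
    fin_cases i
    · exact ⟨_, rfl⟩
    · exact ⟨_, rfl⟩
  · intro hy
    obtain ⟨m, hm⟩ := hy 0
    obtain ⟨n, hn⟩ := hy 1
    refine ⟨pointAt o (m • a + n • b), pointAt_mem_latticePoints ho _, ?_⟩
    rw [basisCoords_pointAt]
    have h1 : cross (m • a + n • b) b = m := by
      simp only [cross, Prod.fst_add, Prod.snd_add, Prod.smul_fst, Prod.smul_snd,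
        smul_eq_mul] at hab ⊢
      linear_combination m * hab
    have h2 : cross a (m • a + n • b) = n := by
      simp only [cross, Prod.fst_add, Prod.snd_add, Prod.smul_fst, Prod.smul_snd,
        smul_eq_mul] at hab ⊢
      linear_combination n * hab
    rw [h1, h2]
    ext i
    fin_cases i
    · exact hm.symm
    · exact hn.symm

/-- Coordinates with origin o and basis a, b send the two short rays to (0, 1) and (-1, -1) and the
end of the long ray to (k, 0). -/
theorem IsIsolatedCenter.latticeEquivalent {S : Finset (Fin 2 → ℝ)} (hS : LatticeSaturated S)
    {o : Fin 2 → ℝ} (h : IsIsolatedCenter S o) :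
    ∃ k : ℕ, 1 ≤ k ∧
      LatticeEquivalent (convexHull ℝ (S : Set (Fin 2 → ℝ))) (exceptionalTriangle k) := by
  have hol := hS.1 h.1
  have hfin : (relativePoints S o).Finite :=
    S.finite_toSet.preimage (pointAt_injective o).injOn
  obtain ⟨a, b, htriple⟩ := h.exists_unimodularTriple hS
  obtain ⟨a, b, k, hk, ⟨ha, hb, hc, hab⟩, hka, hshape⟩ :=
    htriple.exists_shape_of_finite (hS.starClosed h.1) h.noAntipodes hfin
  have hTb : basisCoords o hab (pointAt o b) = ![0, 1] := by
    rw [basisCoords_pointAt, hab]; simp [cross, mul_comm]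
  have hTc : basisCoords o hab (pointAt o (-(a + b))) = ![-1, -1] := by
    have h1 : cross (-(a + b)) b = -1 := by
      simp only [cross, Prod.fst_neg, Prod.snd_neg, Prod.fst_add, Prod.snd_add] at hab ⊢
      linarith
    have h2 : cross a (-(a + b)) = -1 := by
      simp only [cross, Prod.fst_neg, Prod.snd_neg, Prod.fst_add, Prod.snd_add] at hab ⊢
      linarith
    rw [basisCoords_pointAt, h1, h2]; simp
  have hTa : ∀ m : ℕ, basisCoords o hab (pointAt o ((m : ℤ) • a)) = ![(m : ℝ), 0] := by
    intro m
    have h1 : cross ((m : ℤ) • a) b = m := by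
      simp only [cross, Prod.smul_fst, Prod.smul_snd, smul_eq_mul] at hab ⊢
      linear_combination (m : ℤ) * hab
    have h2 : cross a ((m : ℤ) • a) = 0 := by
      simp only [cross, Prod.smul_fst, Prod.smul_snd, smul_eq_mul]
      ring
    rw [basisCoords_pointAt, h1, h2]; simp
  refine ⟨k, hk, basisCoords o hab, basisCoords_image_latticePoints hol hab, ?_⟩
  have himg := (basisCoords o hab).toAffineMap.image_convexHull (S : Set (Fin 2 → ℝ))
  rw [AffineEquiv.coe_toAffineMap] at himg
  rw [himg]
  apply Set.Subset.antisymm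
  · refine convexHull_min ?_ (convex_convexHull ℝ _)
    rintro _ ⟨x, hx, rfl⟩
    obtain ⟨z, rfl⟩ := exists_pointAt_eq hol (hS.1 hx)
    rcases hshape z hx with rfl | rfl | ⟨m, hm, rfl⟩
    · rw [hTb]; exact subset_convexHull ℝ _ (by simp)
    · rw [hTc]; exact subset_convexHull ℝ _ (by simp)
    · rw [hTa]; exact mem_exceptionalTriangle hm
  · refine convexHull_mono ?_
    rintro y (rfl | rfl | rfl)
    · exact ⟨_, hc, hTc⟩
    · exact ⟨_, hb, hTb⟩
    · exact ⟨_, hka, hTa k⟩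

/-! ### From fractional sums to the theorem. -/

/-- Indicator functions of p-element subsets are admissible weights, and admissible weights form a
convex set. -/
theorem exists_isFractionalSum_of_mem_convexHull {n p : ℕ} {S : Finset (Fin n → ℝ)}
    {x : Fin n → ℝ} (hx : x ∈ convexHull ℝ (wedgePower p (S : Set (Fin n → ℝ)))) :
    ∃ w, IsFractionalSum S p x w := by
  classical
  suffices h : convexHull ℝ (wedgePower p (S : Set (Fin n → ℝ))) ⊆
      {x | ∃ w, IsFractionalSum S p x w} from h hx
  refine convexHull_min ?_ ?_
  · rintro _ ⟨U, hU, rfl, rfl⟩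
    have hU' : U ⊆ S := by exact_mod_cast hU
    refine ⟨fun s => if s ∈ U then 1 else 0, fun s _ => ?_, ?_, ?_⟩
    · dsimp only; split_ifs <;> simp
    · rw [Finset.sum_ite_mem, Finset.inter_eq_right.2 hU']; simp
    · simp only [ite_smul, one_smul, zero_smul]
      rw [Finset.sum_ite_mem, Finset.inter_eq_right.2 hU']
  · rintro x ⟨w, hw⟩ y ⟨w', hw'⟩ α β hα hβ hαβ
    refine ⟨fun s => α * w s + β * w' s, fun s hs => ?_, ?_, ?_⟩
    · have h1 := hw.1 s hs
      have h2 := hw'.1 s hs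
      constructor
      · exact add_nonneg (mul_nonneg hα h1.1) (mul_nonneg hβ h2.1)
      · nlinarith
    · rw [Finset.sum_add_distrib, ← Finset.mul_sum, ← Finset.mul_sum, hw.2.1, hw'.2.1, ← add_mul,
        hαβ, one_mul]
    · simp only [add_smul, mul_smul]
      rw [Finset.sum_add_distrib, ← Finset.smul_sum, ← Finset.smul_sum, hw.2.2, hw'.2.2]

theorem isLatticeConvex_wedgePower {n p : ℕ} {S : Finset (Fin n → ℝ)}
    (hS : (S : Set (Fin n → ℝ)) ⊆ latticePoints n) (hp : p ≤ S.card)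
    (h : ∀ x ∈ latticePoints n, ∀ w, IsFractionalSum S p x w →
      x ∈ wedgePower p (S : Set (Fin n → ℝ))) :
    IsLatticeConvex (wedgePower p (S : Set (Fin n → ℝ))) := by
  classical
  have hW : wedgePower p (S : Set (Fin n → ℝ)) =
      ((S.powersetCard p).image fun U => ∑ m ∈ U, m : Finset (Fin n → ℝ)) := by
    ext x
    simp [wedgePower, Finset.mem_powersetCard, and_assoc]
  have hWl : wedgePower p (S : Set (Fin n → ℝ)) ⊆ latticePoints n := by
    rintro _ ⟨U, hU, -, rfl⟩
    exact sum_mem_latticePoints (hU.trans hS)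
  refine ⟨convexHull ℝ (wedgePower p (S : Set (Fin n → ℝ))), ⟨_, ?_, ?_, by rw [hW]⟩, ?_⟩
  · exact (Finset.powersetCard_nonempty.2 hp).image _
  · rw [← hW]; exact hWl
  · apply Set.Subset.antisymm
    · exact fun x hx => ⟨subset_convexHull ℝ _ hx, hWl hx⟩
    · rintro x ⟨hx, hxl⟩
      obtain ⟨w, hw⟩ := exists_isFractionalSum_of_mem_convexHull hx
      exact h x hxl w hw

theorem IsLatticePolytope.exists_latticeSaturated {n : ℕ} {P : Set (Fin n → ℝ)}
    (hP : IsLatticePolytope P) : ∃ S : Finset (Fin n → ℝ), LatticeSaturated S ∧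
      (S : Set (Fin n → ℝ)) = P ∩ latticePoints n ∧
      convexHull ℝ (S : Set (Fin n → ℝ)) = P := by
  have hS : (hP.finite_inter_latticePoints.toFinset : Set (Fin n → ℝ)) = P ∩ latticePoints n :=
    hP.finite_inter_latticePoints.coe_toFinset
  have hconv : convexHull ℝ (P ∩ latticePoints n) = P := by
    obtain ⟨F, -, hF, rfl⟩ := hP
    apply Set.Subset.antisymm
    · exact convexHull_min Set.inter_subset_left (convex_convexHull ℝ _)
    · exact convexHull_mono fun x hx => ⟨subset_convexHull ℝ _ hx, hF hx⟩
  refine ⟨_, ⟨?_, fun x hx hxc => ?_⟩, hS, by rw [hS, hconv]⟩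
  · rw [hS]; exact Set.inter_subset_right
  · rw [hS, hconv] at hxc
    rw [Set.Finite.mem_toFinset]
    exact ⟨hxc, hx⟩

theorem theorem1 :
    (∀ P : Set (Fin 2 → ℝ), IsLatticePolytope P →
      (∀ k : ℕ, 1 ≤ k → ¬ LatticeEquivalent P (exceptionalTriangle k)) →
      ∀ p : ℕ, p ≤ (P ∩ latticePoints 2).ncard →
        IsLatticeConvex (wedgePower p (P ∩ latticePoints 2))) ∧
    (∀ P : Set (Fin 2 → ℝ), IsLatticePolytope P →
      (∃ k : ℕ, 1 ≤ k ∧ LatticeEquivalent P (exceptionalTriangle k)) →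
      6 ≤ (P ∩ latticePoints 2).ncard →
      ∀ p : ℕ, p ≤ (P ∩ latticePoints 2).ncard →
        p ≠ 2 → p ≠ (P ∩ latticePoints 2).ncard - 2 →
        IsLatticeConvex (wedgePower p (P ∩ latticePoints 2))) := by
  refine ⟨fun P hP hne p hp => ?_, fun P hP _ _ p hp hp2 hpN => ?_⟩
  · obtain ⟨S, hS, hSP, hconv⟩ := hP.exists_latticeSaturated
    rw [← hSP, Set.ncard_coe_finset] at hp
    rw [← hSP]
    refine isLatticeConvex_wedgePower hS.1 hp fun x hx w hw => ?_
    rcases mem_wedgePower_or_center hS hx hw with h | ⟨o, ho, -⟩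
    · exact h
    · obtain ⟨k, hk, hequiv⟩ := ho.latticeEquivalent hS
      exact absurd (hconv ▸ hequiv) (hne k hk)
  · obtain ⟨S, hS, hSP, -⟩ := hP.exists_latticeSaturated
    rw [← hSP, Set.ncard_coe_finset] at hp hpN
    rw [← hSP]
    refine isLatticeConvex_wedgePower hS.1 hp fun x hx w hw => ?_
    rcases mem_wedgePower_or_center hS hx hw with h | ⟨o, -, h | h⟩
    · exact h
    · exact absurd h.1 hp2
    · omega
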